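/- Let $a,b,c,d$ be nonnegative integers with $S:=a+b=c+d$, $bc\neq 0$, and put $m:=a-c=d-b$, $\sigma:=m/S$; assume that $\sigma>\tfrac12$ (the urn is balanced, non-triangular and large). Let $(\alpha,\beta)\in\mathbb N^2\setminus\{(0,0)\}$ and let $(U_{(\alpha,\beta)}(n))_{n\ge 0}$ be the composition process of the two-color Pólya urn with initial composition $(\alpha,\beta)$ and replacement matrix $\begin{pmatrix}a&b\\c&d\end{pmatrix}$, that is, the $\mathbb N^2$-valued Markov chain with $U_{(\alpha,\beta)}(0)=(\alpha,\beta)$ that jumps from $(x,y)$ to $(x+a,y+b)$ with probability $\frac{x}{x+y}$ and to $(x+c,y+d)$ with probability $\frac{y}{x+y}$. Let $u_2(x,y)=\frac1S(bx-cy)$. Then the limit $$W^{DT}_{(\alpha,\beta)}:=\lim_{n\to\infty}\frac{1}{n^{\sigma}}\,u_2\bigl(U_{(\alpha,\beta)}(n)\bigr)$$ exists almost surely, the law of the real random variable $W^{DT}_{(\alpha,\beta)}$ has a bounded and continuous density with respect to Lebesgue measure on $\mathbb R$, and its support is the whole real line $\mathbb R$. -/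

import Mathlib

open Filter Topology MeasureTheory

noncomputable section

namespace PolyaUrn

/-- Probability that an urn of composition `u = (red, black)` becomes `v` after one drawing, for
the replacement matrix with rows `(a, b)` and `(c, d)`: a ball is drawn uniformly; if it is red,
`a` red and `b` black balls are added, if it is black, `c` red and `d` black balls are added. -/
def transition (a b c d : ℕ) (u v : ℕ × ℕ) : ℝ :=
  (u.1 : ℝ) / ((u.1 : ℝ) + (u.2 : ℝ)) * (if v = u + (a, b) then 1 else 0) +
    (u.2 : ℝ) / ((u.1 : ℝ) + (u.2 : ℝ)) * (if v = u + (c, d) then 1 else 0)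

/-- `U` is, on the probability space `(Ω, μ)`, the composition process of the discrete-time
two-color Pólya urn with replacement matrix rows `(a, b)`, `(c, d)` and initial composition
`(α, β)`: it is the `ℕ²`-valued Markov chain started at `(α, β)` with the above transition
probabilities. -/
structure IsProcess {Ω : Type*} [MeasurableSpace Ω] (μ : Measure Ω) (a b c d α β : ℕ)
    (U : ℕ → Ω → ℕ × ℕ) : Prop where
  measurable : ∀ n, Measurable (U n)
  init : ∀ᵐ ω ∂μ, U 0 ω = (α, β)
  markov : ∀ (n : ℕ) (h : ℕ → ℕ × ℕ) (v : ℕ × ℕ),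
    μ.real {ω | (∀ k ≤ n, U k ω = h k) ∧ U (n + 1) ω = v} =
      μ.real {ω | ∀ k ≤ n, U k ω = h k} * transition a b c d (h n) v

/-- The ratio `σ = m / S` of the eigenvalues `m = a - c` and `S = a + b` of a balanced replacement
matrix with rows `(a, b)` and `(c, d)`. -/
def ratio (a b c : ℕ) : ℝ := ((a : ℝ) - (c : ℝ)) / ((a : ℝ) + (b : ℝ))

/-- The linear form `u₂ (x, y) = (b x - c y) / S`, where `S = a + b`. -/
def u₂ (a b c : ℕ) (u : ℕ × ℕ) : ℝ :=
  ((b : ℝ) * (u.1 : ℝ) - (c : ℝ) * (u.2 : ℝ)) / ((a : ℝ) + (b : ℝ))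

/-- `W` is a version of the limit variable `W^{DT}` of the process `U`: almost surely,
`W = lim_n u₂ (U n) / n ^ σ`. -/
def IsLimit {Ω : Type*} [MeasurableSpace Ω] (μ : Measure Ω) (a b c : ℕ)
    (U : ℕ → Ω → ℕ × ℕ) (W : Ω → ℝ) : Prop :=
  Measurable W ∧
    ∀ᵐ ω ∂μ, Tendsto (fun n : ℕ => u₂ a b c (U n ω) / (n : ℝ) ^ ratio a b c) atTop (𝓝 (W ω))

end PolyaUrn

end

/-! The form `u₂` is an eigenform of the replacement matrix for the eigenvalue `m = a - c`, so one
drawing from an urn of `s` balls multiplies its mean by `1 + m / s`. Divided by the product `growth`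
of these factors, which is of order `n ^ σ`, it is a martingale with increments `O(1 / growth)`. As
`σ > 1/2`, the inverse squares of `growth` are summable (`summable_inv_growth_sq`), the martingale
is bounded in L², and the limit exists. The same estimate for the characters `exp (i θ u₂)` gives
`limitChar`, the characteristic function of the limit, with uniform control of the convergence.

The density comes from integrability of `limitChar`. With suitable weights, the generating series in
time of the characteristic functions is multiplicative in the initial composition
(`charSeries_add`): a discrete form of the branching property. In the limit this bounds
`|limitChar|` of a sum of two urns by an integral of products (`norm_limitChar_add_le`). For the
maximum over urns of `S` balls, read at `r ^ σ`, it becomes `r χ(r) ≤ (χ * χ)(r)`. The Laplace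
transform `X` of `χ` then satisfies `-X' ≤ X²`, which keeps `X` bounded near `0` because `χ` is not
identically `1`; hence `χ` is integrable (`exists_integral_le_of_mul_le_convolution`). Using this
bound once more gives `|limitChar t| ≤ C t ^ (-1/σ)`, integrable at infinity since `σ < 1`, and
Fourier inversion concludes.

For the support, `growth n = o(n)`, so the values of `u₂ / growth` at compositions reachable at time
`n` become dense in the line (`exists_composition_near`). Given such a composition, the limit has a
conditional mean square deviation from its value there at most a tail of the summable series
(`setIntegral_sq_le`), so it charges every interval (`not_ae_le_abs_sub`). -/

/-! ### Fourier inversion for finite measures on the line -/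

section FourierInversion

open scoped FourierTransform SchwartzMap RealInnerProductSpace

/-- The inverse Fourier transform of the characteristic function, as a candidate density. -/
noncomputable def fourierDensity (μ : Measure ℝ) : ℝ → ℂ :=
  𝓕⁻ (fun ξ : ℝ => charFun μ (-(2 * Real.pi * ξ)))

theorem integrable_charFun_comp {μ : Measure ℝ} (hμ : Integrable (charFun μ)) :
    Integrable (fun ξ : ℝ => charFun μ (-(2 * Real.pi * ξ))) := by
  have := hμ.comp_mul_left' (R := -(2 * Real.pi)) (by simp [Real.pi_ne_zero])
  simpa [neg_mul] using this

theorem continuous_fourierDensity {μ : Measure ℝ} (hμ : Integrable (charFun μ)) :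
    Continuous (fourierDensity μ) := by
  have h := VectorFourier.fourierIntegral_continuous (V := ℝ) (W := ℝ) (μ := volume)
    (L := -innerₗ ℝ) Real.continuous_fourierChar
    (show Continuous fun p : ℝ × ℝ => -(inner ℝ p.1 p.2) from continuous_inner.neg)
    (integrable_charFun_comp hμ)
  refine h.congr fun x => ?_
  simp [fourierDensity, VectorFourier.fourierIntegral, Real.fourierInv_eq, mul_comm]

theorem norm_fourierDensity_le (μ : Measure ℝ) (x : ℝ) :
    ‖fourierDensity μ x‖ ≤ ∫ ξ : ℝ, ‖charFun μ (-(2 * Real.pi * ξ))‖ := by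
  simp only [fourierDensity, Real.fourierInv_eq]
  refine (norm_integral_le_integral_norm _).trans (le_of_eq ?_)
  simp [Circle.norm_smul]

/-- Fubini is used twice: writing `h = 𝓕 (𝓕⁻ h)`, the outer transform moves onto `μ` and produces
`charFun μ`; then the inverse transform on `h` moves onto `charFun μ` and produces the density. -/
theorem integral_schwartz_eq_integral_fourierDensity {μ : Measure ℝ} [IsFiniteMeasure μ]
    (hμ : Integrable (charFun μ)) (h : 𝓢(ℝ, ℂ)) :
    ∫ x, h x ∂μ = ∫ x, h x * fourierDensity μ x := by
  have key1 := VectorFourier.integral_fourierIntegral_smul_eq_flip (V := ℝ) (W := ℝ) (μ := μ)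
    (ν := volume) (L := innerₗ ℝ) (f := fun _ => (1 : ℂ)) (g := fun x => (𝓕⁻ h) x)
    Real.continuous_fourierChar (by simpa using! (continuous_inner (𝕜 := ℝ) (E := ℝ)))
    (integrable_const _) (𝓕⁻ h).integrable
  have key2 := VectorFourier.integral_fourierIntegral_smul_eq_flip (V := ℝ) (W := ℝ)
    (μ := volume) (ν := volume) (L := -innerₗ ℝ) (f := fun x => h x)
    (g := fun ξ : ℝ => charFun μ (-(2 * Real.pi * ξ))) Real.continuous_fourierChar
    (show Continuous fun p : ℝ × ℝ => -(inner ℝ p.1 p.2) from continuous_inner.neg)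
    h.integrable (integrable_charFun_comp hμ)
  have e1 : ∀ x, VectorFourier.fourierIntegral Real.fourierChar volume (innerₗ ℝ).flip
      (fun x => (𝓕⁻ h) x) x = h x := by
    intro x
    have : (𝓕 (𝓕⁻ h)) x = h x := by rw [FourierTransform.fourier_fourierInv_eq]
    rw [← this, SchwartzMap.fourier_coe, Real.fourier_eq]
    simp [VectorFourier.fourierIntegral]
  have e2 : ∀ x, VectorFourier.fourierIntegral Real.fourierChar volume (-innerₗ ℝ)
      (fun x => h x) x = (𝓕⁻ h) x := by
    intro x
    rw [SchwartzMap.fourierInv_coe, Real.fourierInv_eq]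
    simp [VectorFourier.fourierIntegral]
  have e3 : ∀ x, VectorFourier.fourierIntegral Real.fourierChar volume (-innerₗ ℝ).flip
      (fun ξ : ℝ => charFun μ (-(2 * Real.pi * ξ))) x = fourierDensity μ x := by
    intro x
    simp [VectorFourier.fourierIntegral, fourierDensity, Real.fourierInv_eq, mul_comm]
  have e4 : ∀ x, VectorFourier.fourierIntegral Real.fourierChar μ (innerₗ ℝ)
      (fun _ => (1 : ℂ)) x = charFun μ (-(2 * Real.pi * x)) := by
    intro x
    rw [charFun_eq_fourierIntegral']
    congr 1
    simp only [smul_eq_mul]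
    field_simp
  simp only [e1, e4, smul_eq_mul, one_mul] at key1
  simp only [e2, e3, smul_eq_mul] at key2
  rw [← key2, ← key1]
  congr 1; ext x; ring

theorem measureReal_ball_eq_integral_fourierDensity {μ : Measure ℝ} [IsFiniteMeasure μ]
    (hμ : Integrable (charFun μ)) (x : ℝ) {r : ℝ} (hr : 0 < r) :
    μ.real (Metric.ball x r) = ∫ y in Metric.ball x r, (fourierDensity μ y).re := by
  have hcont := continuous_fourierDensity hμ
  -- Smooth bumps equal to `1` on balls whose radii increase to `r`: they converge pointwise to the
  -- indicator of the open ball.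
  let φ : ℕ → ContDiffBump x := fun n =>
    ⟨r * (1 - 1 / ((n : ℝ) + 2)), r, by
      have : 1 / ((n : ℝ) + 2) < 1 := by
        rw [div_lt_one (by positivity)]; linarith [n.cast_nonneg (α := ℝ)]
      exact mul_pos hr (by linarith), by
      have : 0 < 1 / ((n : ℝ) + 2) := by positivity
      nlinarith⟩
  have hlim : ∀ y, Tendsto (fun n => φ n y) atTop
      (𝓝 ((Metric.ball x r).indicator (fun _ => (1 : ℝ)) y)) := by
    intro y
    by_cases hy : y ∈ Metric.ball x r
    · rw [Set.indicator_of_mem hy]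
      have h1 : Tendsto (fun n : ℕ => r * (1 - 1 / ((n : ℝ) + 2))) atTop (𝓝 (r * (1 - 0))) := by
        refine tendsto_const_nhds.mul (tendsto_const_nhds.sub ?_)
        have := (tendsto_one_div_add_atTop_nhds_zero_nat (𝕜 := ℝ)).comp (tendsto_add_atTop_nat 1)
        refine this.congr fun n => ?_
        simp only [Function.comp]; push_cast; ring
      have h2 : ∀ᶠ n : ℕ in atTop, dist y x < r * (1 - 1 / ((n : ℝ) + 2)) :=
        h1.eventually (lt_mem_nhds (by simpa using hy))
      refine tendsto_const_nhds.congr' ?_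
      filter_upwards [h2] with n hn
      exact ((φ n).one_of_mem_closedBall (Metric.mem_closedBall.2 hn.le)).symm
    · rw [Set.indicator_of_notMem hy]
      refine tendsto_const_nhds.congr fun n => ?_
      refine ((φ n).zero_of_le_dist ?_).symm
      simpa using hy
  have hid : ∀ n, ∫ y, φ n y ∂μ = ∫ y, φ n y * (fourierDensity μ y).re := by
    intro n
    have hc : HasCompactSupport (fun y => (φ n y : ℂ)) :=
      (φ n).hasCompactSupport.comp_left (g := fun z : ℝ => (z : ℂ)) (by simp)
    have hs : ContDiff ℝ (⊤ : ℕ∞) (fun y => (φ n y : ℂ)) :=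
      Complex.ofRealCLM.contDiff.comp (φ n).contDiff
    have := integral_schwartz_eq_integral_fourierDensity hμ (hc.toSchwartzMap hs)
    simp only [HasCompactSupport.toSchwartzMap_toFun] at this
    have hi : Integrable (fun y => (φ n y : ℂ) * fourierDensity μ y) :=
      (hs.continuous.mul hcont).integrable_of_hasCompactSupport hc.mul_right
    rw [integral_complex_ofReal] at this
    have h2 := congrArg Complex.re this
    rw [Complex.ofReal_re] at h2
    rw [h2]
    have h3 := integral_re hi
    simp only [RCLike.re_eq_complex_re] at h3
    rw [← h3]
    simp
  have hle : ∀ n y, ‖φ n y‖ ≤ (Metric.closedBall x r).indicator (fun _ => (1 : ℝ)) y := by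
    intro n y
    by_cases hy : y ∈ Metric.closedBall x r
    · rw [Set.indicator_of_mem hy, Real.norm_of_nonneg (φ n).nonneg]; exact (φ n).le_one
    · rw [Set.indicator_of_notMem hy, (φ n).zero_of_le_dist, norm_zero]
      have : r < dist y x := by simpa using hy
      exact this.le
  have l1 : Tendsto (fun n => ∫ y, φ n y ∂μ) atTop (𝓝 (μ.real (Metric.ball x r))) := by
    rw [← integral_indicator_one Metric.isOpen_ball.measurableSet]
    refine tendsto_integral_of_dominated_convergence
      ((Metric.closedBall x r).indicator (fun _ => (1 : ℝ)))
      (fun n => (φ n).continuous.aestronglyMeasurable) ?_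
      (fun n => .of_forall (hle n)) (.of_forall hlim)
    exact (integrable_const _).indicator Metric.isClosed_closedBall.measurableSet
  have l2 : Tendsto (fun n => ∫ y, φ n y * (fourierDensity μ y).re) atTop
      (𝓝 (∫ y in Metric.ball x r, (fourierDensity μ y).re)) := by
    rw [← integral_indicator Metric.isOpen_ball.measurableSet]
    refine tendsto_integral_of_dominated_convergence
      ((Metric.closedBall x r).indicator (fun y => ‖(fourierDensity μ y).re‖))
      (fun n => ((φ n).continuous.mul
        (Complex.continuous_re.comp hcont)).aestronglyMeasurable) ?_
      (fun n => .of_forall fun y => ?_) (.of_forall fun y => ?_)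
    · rw [integrable_indicator_iff Metric.isClosed_closedBall.measurableSet]
      exact (Complex.continuous_re.comp hcont).norm.continuousOn.integrableOn_compact
        (isCompact_closedBall _ _)
    · rw [norm_mul]
      refine (mul_le_mul_of_nonneg_right (hle n y) (norm_nonneg _)).trans (le_of_eq ?_)
      by_cases hy : y ∈ Metric.closedBall x r <;> simp [hy]
    · have := (hlim y).mul_const (fourierDensity μ y).re
      refine this.trans (le_of_eq ?_)
      by_cases hy : y ∈ Metric.ball x r
      · simp only [Set.indicator_of_mem hy, one_mul]
      · simp only [Set.indicator_of_notMem hy, zero_mul]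
  simp only [hid] at l1
  exact tendsto_nhds_unique l1 l2

/-- A finite measure on the line whose characteristic function is integrable has a bounded and
continuous density. -/
theorem exists_continuous_density_of_integrable_charFun {μ : Measure ℝ} [IsFiniteMeasure μ]
    (hμ : Integrable (charFun μ)) :
    ∃ f : ℝ → ℝ, Continuous f ∧ (∀ x, 0 ≤ f x) ∧ (∃ C : ℝ, ∀ x, f x ≤ C) ∧
      μ = volume.withDensity (fun x => ENNReal.ofReal (f x)) := by
  have hcont : Continuous fun x => (fourierDensity μ x).re :=
    Complex.continuous_re.comp (continuous_fourierDensity hμ)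
  have hball := fun x r hr => measureReal_ball_eq_integral_fourierDensity hμ x (r := r) hr
  -- A negative value would persist on a small ball by continuity and give that ball negative
  -- measure.
  have hnn : ∀ x, 0 ≤ (fourierDensity μ x).re := by
    intro x
    by_contra! hx
    obtain ⟨r, hr, hlt⟩ := Metric.eventually_nhds_iff_ball.1
      (hcont.continuousAt.eventually (gt_mem_nhds
        (show (fourierDensity μ x).re < (fourierDensity μ x).re / 2 by linarith)))
    have h1 := hball x r hr
    have h2 : ∫ y in Metric.ball x r, (fourierDensity μ y).re ≤
        ∫ _ in Metric.ball x r, (fourierDensity μ x).re / 2 :=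
      setIntegral_mono_on
        ((hcont.continuousOn.integrableOn_compact (isCompact_closedBall x r)).mono_set
          Metric.ball_subset_closedBall)
        (integrableOn_const measure_ball_lt_top.ne)
        Metric.isOpen_ball.measurableSet fun y hy => (hlt y hy).le
    rw [← h1, setIntegral_const, smul_eq_mul] at h2
    have h3 : 0 < volume.real (Metric.ball x r) := by
      rw [Measure.real, Real.volume_ball, ENNReal.toReal_ofReal (by positivity)]; positivity
    nlinarith [measureReal_nonneg (μ := μ) (s := Metric.ball x r)]
  refine ⟨_, hcont, hnn, ⟨_, fun x => (Complex.re_le_norm _).trans (norm_fourierDensity_le μ x)⟩,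
    Real.measure_ext_Ioo_rat fun p q => ?_⟩
  rcases le_or_gt (q : ℝ) p with h | h
  · simp [Set.Ioo_eq_empty_of_le h]
  · rw [Real.Ioo_eq_ball, withDensity_apply _ Metric.isOpen_ball.measurableSet,
      ← ofReal_integral_eq_lintegral_ofReal
        ((hcont.continuousOn.integrableOn_compact (isCompact_closedBall _ _)).mono_set
          Metric.ball_subset_closedBall) (.of_forall hnn),
      ← hball _ _ (by linarith), ofReal_measureReal]

end FourierInversion

/-! ### Large urns and the increments of `u₂` -/

namespace PolyaUrn

/-- The replacement matrix with rows `(a, b)`, `(c, d)` is balanced, non-triangular and large. -/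
structure IsLarge (a b c d : ℕ) : Prop where
  balanced : a + b = c + d
  b_ne_zero : b ≠ 0
  c_ne_zero : c ≠ 0
  half_lt_ratio : 1 / 2 < ratio a b c

namespace IsLarge

variable {a b c d : ℕ} (h : IsLarge a b c d)
include h

theorem balance_pos : (0 : ℝ) < (a : ℝ) + b := by
  have := Nat.pos_of_ne_zero h.b_ne_zero
  positivity

theorem ratio_pos : 0 < ratio a b c := by linarith [h.half_lt_ratio]

theorem drift_pos : (0 : ℝ) < (a : ℝ) - c := by
  have := h.ratio_pos
  rw [ratio, div_pos_iff_of_pos_right h.balance_pos] at this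
  exact this

theorem ratio_lt_one : ratio a b c < 1 := by
  rw [ratio, div_lt_one h.balance_pos]
  have : (0 : ℝ) < b := by exact_mod_cast Nat.pos_of_ne_zero h.b_ne_zero
  have : (0 : ℝ) < c := by exact_mod_cast Nat.pos_of_ne_zero h.c_ne_zero
  linarith

theorem balanced_real : (a : ℝ) + b = c + d := by exact_mod_cast h.balanced

theorem b_pos : (0 : ℝ) < b := by exact_mod_cast Nat.pos_of_ne_zero h.b_ne_zero

theorem c_pos : (0 : ℝ) < c := by exact_mod_cast Nat.pos_of_ne_zero h.c_ne_zero

theorem a_pos : 0 < a := by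
  have h1 := h.drift_pos
  have h2 := h.c_pos
  have : (0 : ℝ) < a := by linarith
  exact_mod_cast this

theorem d_pos : 0 < d := by
  have h1 := h.drift_pos
  have h2 := h.b_pos
  have h3 := h.balanced_real
  have : (0 : ℝ) < d := by linarith
  exact_mod_cast this

theorem u₂_add_red (u : ℕ × ℕ) :
    u₂ a b c (u + (a, b)) = u₂ a b c u + b * ((a : ℝ) - c) / ((a : ℝ) + b) := by
  simp only [u₂, Prod.fst_add, Prod.snd_add, Nat.cast_add]
  have := h.balance_pos
  field_simp
  ring

theorem u₂_add_black (u : ℕ × ℕ) :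
    u₂ a b c (u + (c, d)) = u₂ a b c u - c * ((a : ℝ) - c) / ((a : ℝ) + b) := by
  simp only [u₂, Prod.fst_add, Prod.snd_add, Nat.cast_add]
  have := h.balance_pos
  have h2 : (d : ℝ) = a + b - c := by linarith [h.balanced_real]
  rw [h2]
  field_simp
  ring

end IsLarge

/-! ### The transition operator and its action on characters -/

/-- The transition operator of the urn, acting on vector-valued functions of the composition. -/
noncomputable def step (a b c d : ℕ) (E : Type*) [AddCommGroup E] [Module ℝ E] :
    Module.End ℝ (ℕ × ℕ → E) where
  toFun f u := ((u.1 : ℝ) / ((u.1 : ℝ) + u.2)) • f (u + (a, b)) +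
    ((u.2 : ℝ) / ((u.1 : ℝ) + u.2)) • f (u + (c, d))
  map_add' f g := by ext u; simp only [Pi.add_apply, smul_add]; abel
  map_smul' r f := by
    ext u
    simp only [Pi.smul_apply, RingHom.id_apply, smul_add, smul_comm r]

theorem step_apply (a b c d : ℕ) {E : Type*} [AddCommGroup E] [Module ℝ E] (f : ℕ × ℕ → E)
    (u : ℕ × ℕ) :
    step a b c d E f u = ((u.1 : ℝ) / ((u.1 : ℝ) + u.2)) • f (u + (a, b)) +
      ((u.2 : ℝ) / ((u.1 : ℝ) + u.2)) • f (u + (c, d)) := rfl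

theorem step_pow_succ_apply (a b c d : ℕ) {E : Type*} [AddCommGroup E] [Module ℝ E]
    (f : ℕ × ℕ → E) (n : ℕ) (u : ℕ × ℕ) :
    (step a b c d E ^ (n + 1)) f u =
      ((u.1 : ℝ) / ((u.1 : ℝ) + u.2)) • (step a b c d E ^ n) f (u + (a, b)) +
      ((u.2 : ℝ) / ((u.1 : ℝ) + u.2)) • (step a b c d E ^ n) f (u + (c, d)) := by
  rw [pow_succ', Module.End.mul_apply, step_apply]

theorem step_pow_succ_apply' (a b c d : ℕ) {E : Type*} [AddCommGroup E] [Module ℝ E]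
    (f : ℕ × ℕ → E) (n : ℕ) (u : ℕ × ℕ) :
    (step a b c d E ^ (n + 1)) f u = (step a b c d E ^ n) (step a b c d E f) u := by
  rw [pow_succ, Module.End.mul_apply]

theorem cast_add_cast_pos {u : ℕ × ℕ} (hu : 0 < u.1 + u.2) : (0 : ℝ) < (u.1 : ℝ) + u.2 := by
  exact_mod_cast hu

theorem proportion_add_eq_one {u : ℕ × ℕ} (hu : 0 < u.1 + u.2) :
    (u.1 : ℝ) / ((u.1 : ℝ) + u.2) + (u.2 : ℝ) / ((u.1 : ℝ) + u.2) = 1 := by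
  rw [← add_div, div_self (cast_add_cast_pos hu).ne']

/-- `step` averages, hence contracts the sup norm. By balance only one total is reached after `n`
drawings, so bounds depending on the total are enough. -/
theorem norm_step_pow_le {a b c d : ℕ} (hS : a + b = c + d) {E : Type*} [NormedAddCommGroup E]
    [NormedSpace ℝ E] {f : ℕ × ℕ → E} {C : ℝ} (n : ℕ) {u : ℕ × ℕ} (hu : 0 < u.1 + u.2)
    (hf : ∀ v : ℕ × ℕ, v.1 + v.2 = u.1 + u.2 + n * (a + b) → ‖f v‖ ≤ C) :
    ‖(step a b c d E ^ n) f u‖ ≤ C := by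
  induction n generalizing u with
  | zero => exact hf u (by simp)
  | succ n ih =>
    rw [step_pow_succ_apply]
    have h1 : ‖(step a b c d E ^ n) f (u + (a, b))‖ ≤ C :=
      ih (by simp; omega) fun v hv => hf v (by simp at hv; rw [hv]; ring)
    have h2 : ‖(step a b c d E ^ n) f (u + (c, d))‖ ≤ C :=
      ih (by simp; omega) fun v hv => hf v (by
        simp at hv; rw [hv, add_mul, one_mul]; omega)
    refine (norm_add_le _ _).trans ?_
    rw [norm_smul, norm_smul, Real.norm_of_nonneg (by positivity),
      Real.norm_of_nonneg (by positivity)]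
    calc _ ≤ (u.1 : ℝ) / ((u.1 : ℝ) + u.2) * C + (u.2 : ℝ) / ((u.1 : ℝ) + u.2) * C := by gcongr
      _ = C := by rw [← add_mul, proportion_add_eq_one hu, one_mul]

/-- The character `exp (i θ u₂)`. -/
noncomputable def wave (a b c : ℕ) (θ : ℝ) (u : ℕ × ℕ) : ℂ :=
  Complex.exp ((θ * u₂ a b c u : ℝ) * Complex.I)

theorem norm_wave (a b c : ℕ) (θ : ℝ) (u : ℕ × ℕ) : ‖wave a b c θ u‖ = 1 :=
  Complex.norm_exp_ofReal_mul_I _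

theorem norm_exp_mul_I_sub_le (x : ℝ) :
    ‖Complex.exp (x * Complex.I) - 1 - x * Complex.I‖ ≤ 3 * x ^ 2 := by
  have hx : ‖(x : ℂ) * Complex.I‖ = |x| := by simp
  rcases le_or_gt |x| 1 with h | h
  · have := Complex.norm_exp_sub_one_sub_id_le (x := x * Complex.I) (by rwa [hx])
    rw [hx, sq_abs] at this
    nlinarith [sq_nonneg x]
  · refine (norm_sub_le _ _).trans ?_
    rw [hx]
    have : ‖Complex.exp (x * Complex.I) - 1‖ ≤ 1 + 1 := by
      refine (norm_sub_le _ _).trans ?_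
      rw [Complex.norm_exp_ofReal_mul_I]; simp
    have h2 := sq_abs x
    nlinarith

/-- The eigenform property: the mean increment of `u₂` is proportional to `u₂` itself. -/
theorem IsLarge.mean_increment {a b c d : ℕ} (h : IsLarge a b c d) {u : ℕ × ℕ}
    (hu : 0 < u.1 + u.2) :
    (u.1 : ℝ) / ((u.1 : ℝ) + u.2) * (b * ((a : ℝ) - c) / ((a : ℝ) + b)) -
      (u.2 : ℝ) / ((u.1 : ℝ) + u.2) * (c * ((a : ℝ) - c) / ((a : ℝ) + b)) =
      ((a : ℝ) - c) / ((u.1 : ℝ) + u.2) * u₂ a b c u := by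
  have := cast_add_cast_pos hu
  have := h.balance_pos
  rw [u₂]
  field_simp

theorem IsLarge.spread_le {a b c d : ℕ} (h : IsLarge a b c d) :
    b * ((a : ℝ) - c) / ((a : ℝ) + b) + c * ((a : ℝ) - c) / ((a : ℝ) + b) ≤ (a : ℝ) + b := by
  have h0 := h.balance_pos
  have h1 := h.drift_pos
  have h2 : (a : ℝ) - c ≤ a + b := by linarith [h.b_pos, h.c_pos]
  rw [← add_div, div_le_iff₀ h0, ← add_mul]
  have h3 : (b : ℝ) + c ≤ a + b := by linarith
  exact mul_le_mul h3 h2 h1.le h0.le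

/-- The exponential is expanded around the mean of `u₂` after one drawing. First-order terms average
to zero, and the deviations are at most `S = a + b`, so only a quadratic error in `θ` remains. -/
theorem IsLarge.norm_step_wave_sub_le {a b c d : ℕ} (h : IsLarge a b c d) (θ : ℝ) {u : ℕ × ℕ}
    (hu : 0 < u.1 + u.2) :
    ‖step a b c d ℂ (wave a b c θ) u -
      wave a b c (θ * (1 + ((a : ℝ) - c) / ((u.1 : ℝ) + u.2))) u‖ ≤
      3 * ((a : ℝ) + b) ^ 2 * θ ^ 2 := by
  have hpq := proportion_add_eq_one hu
  have hmean := h.mean_increment hu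
  have hspread := h.spread_le
  rw [step_apply]
  simp only [wave, h.u₂_add_red, h.u₂_add_black]
  set p := (u.1 : ℝ) / ((u.1 : ℝ) + u.2) with hp
  set q := (u.2 : ℝ) / ((u.1 : ℝ) + u.2) with hq
  set x := b * ((a : ℝ) - c) / ((a : ℝ) + b) with hx
  set y := c * ((a : ℝ) - c) / ((a : ℝ) + b) with hy
  set w := u₂ a b c u
  set z := ((a : ℝ) - c) / ((u.1 : ℝ) + u.2) * w with hz
  have hp0 : 0 ≤ p := by positivity
  have hq0 : 0 ≤ q := by positivity
  have hx0 : 0 ≤ x := div_nonneg (mul_nonneg h.b_pos.le h.drift_pos.le) h.balance_pos.le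
  have hy0 : 0 ≤ y := div_nonneg (mul_nonneg h.c_pos.le h.drift_pos.le) h.balance_pos.le
  have e1 : θ * (w + x) = θ * (w + z) + θ * (x - z) := by ring
  have e2 : θ * (w - y) = θ * (w + z) + θ * (-y - z) := by ring
  have e3 : θ * (1 + ((a : ℝ) - c) / ((u.1 : ℝ) + u.2)) * w = θ * (w + z) := by rw [hz]; ring
  have h1 := norm_exp_mul_I_sub_le (θ * (x - z))
  have h2 := norm_exp_mul_I_sub_le (θ * (-y - z))
  have b1 : (x - z) ^ 2 ≤ ((a : ℝ) + b) ^ 2 := by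
    have : x - z = q * (x + y) := by rw [← hmean]; linear_combination -x * hpq
    rw [this]
    have : q ≤ 1 := by linarith
    have : q * (x + y) ≤ 1 * (a + b) := mul_le_mul this hspread (by positivity) (by simp)
    exact pow_le_pow_left₀ (by positivity) (by linarith) 2
  have b2 : (-y - z) ^ 2 ≤ ((a : ℝ) + b) ^ 2 := by
    have : -y - z = -(p * (x + y)) := by rw [← hmean]; linear_combination y * hpq
    rw [this, neg_sq]
    have : p ≤ 1 := by linarith
    have : p * (x + y) ≤ 1 * (a + b) := mul_le_mul this hspread (by positivity) (by simp)
    exact pow_le_pow_left₀ (by positivity) (by linarith) 2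
  rw [mul_pow] at h1 h2
  rw [e1, e2, e3]
  have hmeanC : (p : ℂ) * ((θ * (x - z) : ℝ) * Complex.I) +
      q * ((θ * (-y - z) : ℝ) * Complex.I) = 0 := by
    have : p * (θ * (x - z)) + q * (θ * (-y - z)) = 0 := by
      linear_combination θ * hmean - θ * z * hpq
    have h' := congrArg (fun r : ℝ => (r : ℂ) * Complex.I) this
    push_cast at h' ⊢
    linear_combination h'
  have hpqC : (p : ℂ) + q = 1 := by exact_mod_cast hpq
  have key : p • Complex.exp ((θ * (w + z) + θ * (x - z) : ℝ) * Complex.I) +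
      q • Complex.exp ((θ * (w + z) + θ * (-y - z) : ℝ) * Complex.I) -
      Complex.exp ((θ * (w + z) : ℝ) * Complex.I) =
      Complex.exp ((θ * (w + z) : ℝ) * Complex.I) *
      (p * (Complex.exp ((θ * (x - z) : ℝ) * Complex.I) - 1 - (θ * (x - z) : ℝ) * Complex.I) +
      q * (Complex.exp ((θ * (-y - z) : ℝ) * Complex.I) - 1
        - (θ * (-y - z) : ℝ) * Complex.I)) := by
    rw [Complex.ofReal_add (θ * (w + z)), Complex.ofReal_add (θ * (w + z)), add_mul, add_mul,
      Complex.exp_add, Complex.exp_add]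
    simp only [Complex.real_smul]
    linear_combination Complex.exp ((θ * (w + z) : ℝ) * Complex.I) * (hmeanC + hpqC)
  rw [key, norm_mul, Complex.norm_exp_ofReal_mul_I, one_mul]
  refine (norm_add_le _ _).trans ?_
  rw [norm_mul, norm_mul, Complex.norm_of_nonneg hp0, Complex.norm_of_nonneg hq0]
  calc _ ≤ p * (3 * (θ ^ 2 * ((a : ℝ) + b) ^ 2)) + q * (3 * (θ ^ 2 * ((a : ℝ) + b) ^ 2)) := by
        gcongr
        · exact h1.trans (by gcongr)
        · exact h2.trans (by gcongr)
    _ = _ := by linear_combination 3 * (θ ^ 2 * ((a : ℝ) + b) ^ 2) * hpq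

/-! ### Characteristic functions at finite time and growth factors -/

/-- The characteristic function of `u₂ (U n)` for the urn process started at `u`. -/
noncomputable def charSeq (a b c d n : ℕ) (θ : ℝ) (u : ℕ × ℕ) : ℂ :=
  (step a b c d ℂ ^ n) (wave a b c θ) u

theorem norm_charSeq_le {a b c d : ℕ} (hS : a + b = c + d) (n : ℕ) (θ : ℝ) {u : ℕ × ℕ}
    (hu : 0 < u.1 + u.2) : ‖charSeq a b c d n θ u‖ ≤ 1 :=
  norm_step_pow_le hS n hu fun _ _ => (norm_wave ..).le

theorem charSeq_succ (a b c d n : ℕ) (θ : ℝ) (u : ℕ × ℕ) :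
    charSeq a b c d (n + 1) θ u =
      ((u.1 : ℝ) / ((u.1 : ℝ) + u.2)) • charSeq a b c d n θ (u + (a, b)) +
      ((u.2 : ℝ) / ((u.1 : ℝ) + u.2)) • charSeq a b c d n θ (u + (c, d)) :=
  step_pow_succ_apply ..

theorem continuous_charSeq (a b c d n : ℕ) (u : ℕ × ℕ) :
    Continuous fun θ => charSeq a b c d n θ u := by
  induction n generalizing u with
  | zero =>
    simp only [charSeq, pow_zero, Module.End.one_apply, wave]
    fun_prop
  | succ n ih =>
    simp only [charSeq_succ]
    exact ((ih _).const_smul (_ : ℝ)).add ((ih _).const_smul (_ : ℝ))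

/-- The one-step estimate is applied to the last drawing. The total before it is deterministic, so
the modified frequency is the same on all trajectories. -/
theorem IsLarge.norm_charSeq_succ_sub_le {a b c d : ℕ} (h : IsLarge a b c d) (n : ℕ) (θ : ℝ)
    {u : ℕ × ℕ} (hu : 0 < u.1 + u.2) :
    ‖charSeq a b c d (n + 1) θ u - charSeq a b c d n
      (θ * (1 + ((a : ℝ) - c) / ((u.1 + u.2 : ℕ) + n * ((a : ℝ) + b)))) u‖ ≤
      3 * ((a : ℝ) + b) ^ 2 * θ ^ 2 := by
  rw [charSeq, charSeq, step_pow_succ_apply', ← Pi.sub_apply, ← map_sub]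
  refine norm_step_pow_le h.balanced n hu fun v hv => ?_
  have hv' : ((u.1 + u.2 : ℕ) : ℝ) + n * ((a : ℝ) + b) = (v.1 : ℝ) + v.2 := by
    exact_mod_cast hv.symm
  rw [hv', Pi.sub_apply]
  exact h.norm_step_wave_sub_le θ (by omega)

/-- The mean growth of `u₂` in `n` drawings, for an urn of initially `s` balls. -/
noncomputable def growth (a b c s n : ℕ) : ℝ :=
  ∏ j ∈ Finset.range n, (1 + ((a : ℝ) - c) / (s + j * ((a : ℝ) + b)))

theorem growth_zero (a b c s : ℕ) : growth a b c s 0 = 1 := by simp [growth]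

theorem growth_succ (a b c s n : ℕ) : growth a b c s (n + 1) =
    growth a b c s n * (1 + ((a : ℝ) - c) / (s + n * ((a : ℝ) + b))) :=
  Finset.prod_range_succ ..

/-- The limit of `growth a b c s n / n ^ ratio a b c`. -/
noncomputable def growthConst (a b c s : ℕ) : ℝ :=
  Real.Gamma (s / ((a : ℝ) + b)) / Real.Gamma (s / ((a : ℝ) + b) + ratio a b c)

namespace IsLarge

variable {a b c d : ℕ} (h : IsLarge a b c d)
include h

theorem one_le_factor (s n : ℕ) :
    (1 : ℝ) ≤ 1 + ((a : ℝ) - c) / (s + n * ((a : ℝ) + b)) := by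
  have := h.drift_pos
  have := h.balance_pos
  have : 0 ≤ ((a : ℝ) - c) / (s + n * ((a : ℝ) + b)) := by positivity
  linarith

theorem one_le_growth (s n : ℕ) : 1 ≤ growth a b c s n :=
  Finset.prod_induction _ (fun x : ℝ => 1 ≤ x)
    (fun _ _ hx hy => one_le_mul_of_one_le_of_one_le hx hy)
    le_rfl fun i _ => h.one_le_factor s i

theorem growth_pos (s n : ℕ) : 0 < growth a b c s n := zero_lt_one.trans_le (h.one_le_growth s n)

theorem growthConst_pos {s : ℕ} (hs : 0 < s) : 0 < growthConst a b c s := by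
  have h1 := h.balance_pos
  have h2 := h.ratio_pos
  have h3 : (0 : ℝ) < s := by exact_mod_cast hs
  exact div_pos (Real.Gamma_pos_of_pos (by positivity)) (Real.Gamma_pos_of_pos (by positivity))

theorem tendsto_growth_div {s : ℕ} (hs : 0 < s) :
    Tendsto (fun n : ℕ => growth a b c s n / (n : ℝ) ^ ratio a b c) atTop
      (𝓝 (growthConst a b c s)) := by
  have h1 := h.balance_pos
  have h2 := h.ratio_pos
  have h3 : (0 : ℝ) < s := by exact_mod_cast hs
  set p := (s : ℝ) / ((a : ℝ) + b) with hp
  have hp0 : 0 < p := by positivity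
  set σ := ratio a b c with hσ
  have key : ∀ n : ℕ, growth a b c s (n + 1) =
      (∏ j ∈ Finset.range (n + 1), (p + σ + j)) / ∏ j ∈ Finset.range (n + 1), (p + j) := by
    intro n
    rw [growth, ← Finset.prod_div_distrib]
    refine Finset.prod_congr rfl fun j _ => ?_
    rw [hp, hσ, ratio]
    have : (0 : ℝ) < s + j * ((a : ℝ) + b) := by positivity
    field_simp
    ring
  -- The quotient of rising products is a ratio of two terms of Euler's sequence for the Gamma
  -- function, at `p` and `p + σ`.
  have lim1 : Tendsto (fun n : ℕ => growth a b c s (n + 1) / (n : ℝ) ^ σ) atTop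
      (𝓝 (growthConst a b c s)) := by
    refine ((Real.GammaSeq_tendsto_Gamma p).div (Real.GammaSeq_tendsto_Gamma (p + σ))
      (Real.Gamma_pos_of_pos (by positivity)).ne').congr' ?_
    filter_upwards [eventually_gt_atTop 0] with n hn
    have hn' : (0 : ℝ) < n := by exact_mod_cast hn
    have q1 : 0 < ∏ j ∈ Finset.range (n + 1), (p + σ + j) :=
      Finset.prod_pos fun j _ => by positivity
    have q2 : 0 < ∏ j ∈ Finset.range (n + 1), (p + j) := Finset.prod_pos fun j _ => by positivity
    simp only [Pi.div_apply, Real.GammaSeq]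
    rw [key, Real.rpow_add hn']
    have := Real.rpow_pos_of_pos hn' σ
    have := Real.rpow_pos_of_pos hn' p
    have : (0 : ℝ) < n.factorial := by exact_mod_cast n.factorial_pos
    field_simp
  have lim2 : Tendsto (fun n : ℕ => 1 + ((a : ℝ) - c) / (s + n * ((a : ℝ) + b))) atTop
      (𝓝 (1 + 0)) := by
    refine tendsto_const_nhds.add (tendsto_const_nhds.div_atTop ?_)
    exact tendsto_atTop_add_const_left _ _ (tendsto_natCast_atTop_atTop.atTop_mul_const h1)
  have := lim1.div lim2 (by simp)
  rw [add_zero, div_one] at this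
  refine this.congr fun n => ?_
  have := (zero_lt_one.trans_le (h.one_le_factor s n)).ne'
  simp only [Pi.div_apply]
  rw [growth_succ, div_div, mul_comm _ (1 + _ : ℝ), mul_comm _ (1 + _ : ℝ),
    mul_div_mul_left _ _ this]

/-- Largeness enters here: the terms are of order `n ^ (-2σ)` with `2σ > 1`. -/
theorem summable_inv_growth_sq {s : ℕ} (hs : 0 < s) :
    Summable fun n => 1 / growth a b c s n ^ 2 := by
  have hσ := h.half_lt_ratio
  have hsum : Summable fun n : ℕ => (n : ℝ) ^ (-(2 * ratio a b c)) :=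
    Real.summable_nat_rpow.2 (by linarith)
  refine summable_of_isBigO_nat hsum ?_
  have hκ := h.growthConst_pos hs
  have hlow : ∀ᶠ n : ℕ in atTop, growthConst a b c s / 2 <
      growth a b c s n / (n : ℝ) ^ ratio a b c :=
    (h.tendsto_growth_div hs).eventually (lt_mem_nhds (by linarith))
  refine Asymptotics.IsBigO.of_bound (1 / (growthConst a b c s / 2) ^ 2) ?_
  filter_upwards [hlow, eventually_gt_atTop 0] with n hn hn0
  have hn0' : (0 : ℝ) < n := by exact_mod_cast hn0
  have hr := Real.rpow_pos_of_pos hn0' (ratio a b c)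
  rw [lt_div_iff₀ hr] at hn
  rw [Real.norm_of_nonneg (by positivity), Real.norm_of_nonneg (by positivity),
    Real.rpow_neg hn0'.le, two_mul, Real.rpow_add hn0', ← sq, ← one_div, one_div_mul_one_div,
    ← mul_pow]
  exact one_div_le_one_div_of_le (by positivity) (pow_le_pow_left₀ (by positivity) hn.le 2)

end IsLarge

/-- The tail of the series of the inverse squares of the growth factors. -/
noncomputable def growthTail (a b c s n : ℕ) : ℝ := ∑' k, 1 / growth a b c s (n + k + 1) ^ 2

theorem tendsto_growthTail (a b c s : ℕ) :
    Tendsto (growthTail a b c s) atTop (𝓝 0) := by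
  have := (tendsto_sum_nat_add fun n => 1 / growth a b c s n ^ 2).comp (tendsto_add_atTop_nat 1)
  refine this.congr fun n => ?_
  simp only [Function.comp, growthTail]
  congr 1; ext k
  rw [show k + (n + 1) = n + k + 1 by ring]

namespace IsLarge

variable {a b c d : ℕ} (h : IsLarge a b c d)
include h

theorem sum_le_growthTail {s : ℕ} (hs : 0 < s) (n k : ℕ) :
    ∑ j ∈ Finset.range k, 1 / growth a b c s (n + j + 1) ^ 2 ≤ growthTail a b c s n := by
  refine Summable.sum_le_tsum _ (fun i _ => by positivity) ?_
  have := (summable_nat_add_iff (n + 1)).2 (h.summable_inv_growth_sq hs)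
  refine this.congr fun k => ?_
  rw [show k + (n + 1) = n + k + 1 by ring]

end IsLarge

/-! ### The limit characteristic function -/

/-- The limit of the characteristic functions of `u₂ (U n) / growth n` for the urn process started
at `u`. -/
noncomputable def scaledLimitChar (a b c d : ℕ) (u : ℕ × ℕ) (τ : ℝ) : ℂ :=
  limUnder atTop fun n => charSeq a b c d n (τ / growth a b c (u.1 + u.2) n) u

/-- The limit of the characteristic functions of `u₂ (U n) / n ^ σ` for the urn process started
at `u`. -/
noncomputable def limitChar (a b c d : ℕ) (u : ℕ × ℕ) (t : ℝ) : ℂ :=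
  scaledLimitChar a b c d u (growthConst a b c (u.1 + u.2) * t)

namespace IsLarge

variable {a b c d : ℕ} (h : IsLarge a b c d)
include h

/-- At frequency `τ / growth`, the factor gained by one drawing cancels exactly and only the
quadratic error survives. -/
theorem dist_charSeq_succ_le {u : ℕ × ℕ} (hu : 0 < u.1 + u.2) (τ : ℝ) (n : ℕ) :
    dist (charSeq a b c d n (τ / growth a b c (u.1 + u.2) n) u)
      (charSeq a b c d (n + 1) (τ / growth a b c (u.1 + u.2) (n + 1)) u) ≤
      3 * ((a : ℝ) + b) ^ 2 * τ ^ 2 * (1 / growth a b c (u.1 + u.2) (n + 1) ^ 2) := by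
  have h1 := h.norm_charSeq_succ_sub_le n (τ / growth a b c (u.1 + u.2) (n + 1)) hu
  have h2 := (zero_lt_one.trans_le (h.one_le_factor (u.1 + u.2) n)).ne'
  have h3 : τ / growth a b c (u.1 + u.2) (n + 1) *
      (1 + ((a : ℝ) - c) / ((u.1 + u.2 : ℕ) + n * ((a : ℝ) + b))) =
      τ / growth a b c (u.1 + u.2) n := by
    rw [growth_succ, div_mul_eq_mul_div, mul_div_mul_right _ _ h2]
  rw [h3] at h1
  rw [dist_comm, dist_eq_norm]
  refine h1.trans (le_of_eq ?_)
  rw [div_pow]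
  ring

theorem summable_dist_bound {s : ℕ} (hs : 0 < s) (C : ℝ) :
    Summable fun n => C * (1 / growth a b c s (n + 1) ^ 2) :=
  ((summable_nat_add_iff 1).2 (h.summable_inv_growth_sq hs)).mul_left C

/-- Summation of the one-step distances. Large `n` gives locally uniform convergence; `n = 0` gives
the expansion of the limit at the origin. -/
theorem norm_charSeq_sub_scaledLimitChar_le {u : ℕ × ℕ} (hu : 0 < u.1 + u.2) (θ : ℝ) (n : ℕ) :
    ‖charSeq a b c d n θ u -
      scaledLimitChar a b c d u (θ * growth a b c (u.1 + u.2) n)‖ ≤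
      3 * ((a : ℝ) + b) ^ 2 * (θ * growth a b c (u.1 + u.2) n) ^ 2 *
        growthTail a b c (u.1 + u.2) n := by
  set τ := θ * growth a b c (u.1 + u.2) n with hτ
  have hd := h.dist_charSeq_succ_le hu τ
  have hs := h.summable_dist_bound hu (3 * ((a : ℝ) + b) ^ 2 * τ ^ 2)
  have hlim : Tendsto (fun n => charSeq a b c d n (τ / growth a b c (u.1 + u.2) n) u) atTop
      (𝓝 (scaledLimitChar a b c d u τ)) :=
    (cauchySeq_of_dist_le_of_summable _ hd hs).tendsto_limUnder
  have := dist_le_tsum_of_dist_le_of_tendsto _ hd hs hlim n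
  rw [dist_eq_norm, hτ, mul_div_cancel_right₀ _ (h.growth_pos _ n).ne', ← hτ, tsum_mul_left] at this
  exact this

theorem growthTail_nonneg (s n : ℕ) : 0 ≤ growthTail a b c s n :=
  tsum_nonneg fun k => by have := h.growth_pos s (n + k + 1); positivity

theorem continuous_scaledLimitChar {u : ℕ × ℕ} (hu : 0 < u.1 + u.2) :
    Continuous (scaledLimitChar a b c d u) := by
  have hγ := h.growth_pos (u.1 + u.2)
  refine (tendstoLocallyUniformly_iff_forall_isCompact.2 fun s hs =>
    Metric.tendstoUniformlyOn_iff.2 fun ε hε => ?_ :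
    TendstoLocallyUniformly (fun n τ => charSeq a b c d n (τ / growth a b c (u.1 + u.2) n) u)
      (scaledLimitChar a b c d u) atTop).continuous
    (.of_forall fun n => (continuous_charSeq a b c d n u).comp (continuous_id.div_const _))
  obtain ⟨R, hR⟩ := hs.isBounded.exists_norm_le
  have hlim : Tendsto (fun n => 3 * ((a : ℝ) + b) ^ 2 * R ^ 2 * growthTail a b c (u.1 + u.2) n)
      atTop (𝓝 (3 * ((a : ℝ) + b) ^ 2 * R ^ 2 * 0)) :=
    (tendsto_growthTail a b c (u.1 + u.2)).const_mul _
  rw [mul_zero] at hlim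
  filter_upwards [hlim.eventually (gt_mem_nhds hε)] with n hn τ hτ
  have := h.norm_charSeq_sub_scaledLimitChar_le hu (τ / growth a b c (u.1 + u.2) n) n
  rw [div_mul_cancel₀ _ (hγ n).ne'] at this
  rw [dist_comm, dist_eq_norm]
  refine this.trans_lt (lt_of_le_of_lt ?_ hn)
  have h1 : τ ^ 2 ≤ R ^ 2 := by
    rw [← sq_abs τ]; exact pow_le_pow_left₀ (abs_nonneg _) (hR τ hτ) 2
  exact mul_le_mul_of_nonneg_right (mul_le_mul_of_nonneg_left h1 (by positivity))
    (h.growthTail_nonneg _ n)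

theorem continuous_limitChar {u : ℕ × ℕ} (hu : 0 < u.1 + u.2) :
    Continuous (limitChar a b c d u) :=
  (h.continuous_scaledLimitChar hu).comp (continuous_const_mul _)

/-- Time and frequency may vary together: only the product `θ k ^ σ` matters. This covers both the
shift by one drawing and times proportional to `n`. -/
theorem tendsto_charSeq {u : ℕ × ℕ} (hu : 0 < u.1 + u.2) {ι : Type*} {l : Filter ι} {k : ι → ℕ}
    {θ : ι → ℝ} {t : ℝ} (hk : Tendsto k l atTop)
    (hθ : Tendsto (fun i => θ i * (k i : ℝ) ^ ratio a b c) l (𝓝 t)) :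
    Tendsto (fun i => charSeq a b c d (k i) (θ i) u) l (𝓝 (limitChar a b c d u t)) := by
  have h1 : Tendsto (fun i => θ i * growth a b c (u.1 + u.2) (k i)) l
      (𝓝 (growthConst a b c (u.1 + u.2) * t)) := by
    have := ((h.tendsto_growth_div hu).comp hk).mul hθ
    refine this.congr' ?_
    filter_upwards [hk.eventually (eventually_gt_atTop 0)] with i hi
    have : (0 : ℝ) < k i := by exact_mod_cast hi
    have := Real.rpow_pos_of_pos this (ratio a b c)
    simp only [Function.comp]
    field_simp
  have h2 := ((h.continuous_scaledLimitChar hu).tendsto _).comp h1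
  have h3 : Tendsto (fun i => 3 * ((a : ℝ) + b) ^ 2 *
      (θ i * growth a b c (u.1 + u.2) (k i)) ^ 2 * growthTail a b c (u.1 + u.2) (k i)) l
      (𝓝 (3 * ((a : ℝ) + b) ^ 2 * (growthConst a b c (u.1 + u.2) * t) ^ 2 * 0)) :=
    ((h1.pow 2).const_mul _).mul ((tendsto_growthTail a b c (u.1 + u.2)).comp hk)
  rw [mul_zero] at h3
  have h4 := squeeze_zero_norm
    (fun i => h.norm_charSeq_sub_scaledLimitChar_le hu (θ i) (k i)) h3
  have h5 := h4.add h2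
  rw [zero_add] at h5
  refine h5.congr fun i => ?_
  simp [Function.comp]

theorem tendsto_charSeq_div_rpow {u : ℕ × ℕ} (hu : 0 < u.1 + u.2) (t : ℝ) :
    Tendsto (fun n : ℕ => charSeq a b c d n (t / (n : ℝ) ^ ratio a b c) u) atTop
      (𝓝 (limitChar a b c d u t)) := by
  refine h.tendsto_charSeq hu tendsto_id ?_
  refine tendsto_const_nhds.congr' ?_
  filter_upwards [eventually_gt_atTop 0] with n hn
  have : (0 : ℝ) < n := by exact_mod_cast hn
  have := Real.rpow_pos_of_pos this (ratio a b c)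
  exact (div_mul_cancel₀ _ this.ne').symm

theorem norm_limitChar_le_one {u : ℕ × ℕ} (hu : 0 < u.1 + u.2) (t : ℝ) :
    ‖limitChar a b c d u t‖ ≤ 1 :=
  le_of_tendsto (h.tendsto_charSeq_div_rpow hu t).norm
    (.of_forall fun n => norm_charSeq_le h.balanced n _ hu)

theorem limitChar_eq {u : ℕ × ℕ} (hu : 0 < u.1 + u.2) (t : ℝ) :
    limitChar a b c d u t =
      ((u.1 : ℝ) / ((u.1 : ℝ) + u.2)) • limitChar a b c d (u + (a, b)) t +
      ((u.2 : ℝ) / ((u.1 : ℝ) + u.2)) • limitChar a b c d (u + (c, d)) t := by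
  have h1 : Tendsto (fun n : ℕ => charSeq a b c d (n + 1) (t / (n : ℝ) ^ ratio a b c) u) atTop
      (𝓝 (limitChar a b c d u t)) := by
    refine h.tendsto_charSeq hu (tendsto_add_atTop_nat 1) ?_
    have h2 : Tendsto (fun n : ℕ => t * (((n + 1 : ℕ) : ℝ) / n) ^ ratio a b c) atTop
        (𝓝 (t * 1 ^ ratio a b c)) := by
      refine Tendsto.const_mul _ (Tendsto.rpow_const ?_ (.inl one_ne_zero))
      have := (tendsto_const_nhds (x := (1 : ℝ))).add (tendsto_one_div_atTop_nhds_zero_nat (𝕜 := ℝ))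
      rw [add_zero] at this
      refine this.congr' ?_
      filter_upwards [eventually_gt_atTop 0] with n hn
      have : (0 : ℝ) < n := by exact_mod_cast hn
      push_cast
      field_simp
    rw [Real.one_rpow, mul_one] at h2
    refine h2.congr fun n => ?_
    rw [Real.div_rpow (by positivity) (by positivity)]
    ring
  refine tendsto_nhds_unique h1 ?_
  simp only [charSeq_succ]
  exact ((h.tendsto_charSeq_div_rpow (by simp; omega) t).const_smul _).add
    ((h.tendsto_charSeq_div_rpow (by simp; omega) t).const_smul _)

theorem norm_limitChar_sub_wave_le {u : ℕ × ℕ} (hu : 0 < u.1 + u.2) (t : ℝ) :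
    ‖limitChar a b c d u t - wave a b c (growthConst a b c (u.1 + u.2) * t) u‖ ≤
      3 * ((a : ℝ) + b) ^ 2 * growthConst a b c (u.1 + u.2) ^ 2 *
        growthTail a b c (u.1 + u.2) 0 * t ^ 2 := by
  have := h.norm_charSeq_sub_scaledLimitChar_le hu (growthConst a b c (u.1 + u.2) * t) 0
  rw [growth_zero, mul_one, norm_sub_rev] at this
  refine this.trans (le_of_eq ?_)
  ring

theorem limitChar_zero {u : ℕ × ℕ} (hu : 0 < u.1 + u.2) : limitChar a b c d u 0 = 1 := by
  have := h.norm_limitChar_sub_wave_le hu 0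
  simpa [wave, sub_eq_zero] using this

theorem hasDerivAt_limitChar_zero {u : ℕ × ℕ} (hu : 0 < u.1 + u.2) :
    HasDerivAt (limitChar a b c d u)
      ((growthConst a b c (u.1 + u.2) * u₂ a b c u : ℝ) * Complex.I) 0 := by
  set κ := growthConst a b c (u.1 + u.2)
  have h1 : HasDerivAt (fun t : ℝ => wave a b c (κ * t) u)
      ((κ * u₂ a b c u : ℝ) * Complex.I) 0 := by
    have h2 : HasDerivAt (fun t : ℝ => ((κ * t * u₂ a b c u : ℝ) : ℂ) * Complex.I)
        ((κ * u₂ a b c u : ℝ) * Complex.I) 0 := by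
      refine HasDerivAt.mul_const (HasDerivAt.ofReal_comp ?_) _
      simpa using ((hasDerivAt_id (0 : ℝ)).const_mul κ).mul_const (u₂ a b c u)
    simpa [wave] using h2.cexp
  have h3 : HasDerivAt (fun t => limitChar a b c d u t - wave a b c (κ * t) u) 0 0 := by
    rw [hasDerivAt_iff_isLittleO_nhds_zero]
    simp only [zero_add, mul_zero, smul_zero, sub_zero, h.limitChar_zero hu]
    have h4 : wave a b c 0 u = 1 := by simp [wave]
    rw [h4, sub_self]
    simp only [sub_zero]
    refine (Asymptotics.IsBigO.of_bound
      (3 * ((a : ℝ) + b) ^ 2 * κ ^ 2 * growthTail a b c (u.1 + u.2) 0) (.of_forall fun t => ?_) :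
      _ =O[𝓝 0] fun t : ℝ => t ^ 2).trans_isLittleO ?_
    · rw [norm_pow, Real.norm_eq_abs, sq_abs]
      exact h.norm_limitChar_sub_wave_le hu t
    · simpa using Asymptotics.isLittleO_pow_id (𝕜 := ℝ) one_lt_two
  have h5 := h3.add h1
  rw [zero_add] at h5
  exact h5.congr_of_eventuallyEq (.of_forall fun t => by simp)

/-- The two urns reached by one drawing have equal totals but different `u₂`, so their limit
functions have different derivatives at `0` and differ at small `t ≠ 0`. Strict convexity of the
disc then makes their average smaller than `1` in modulus. -/
theorem eventually_norm_limitChar_lt_one_of_pos {u : ℕ × ℕ} (h1 : 0 < u.1) (h2 : 0 < u.2) :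
    ∀ᶠ t in 𝓝[≠] 0, ‖limitChar a b c d u t‖ < 1 := by
  have hS := h.balanced
  have hr : 0 < (u + (a, b)).1 + (u + (a, b)).2 := by simp; omega
  have hb : 0 < (u + (c, d)).1 + (u + (c, d)).2 := by simp; omega
  have hrb : (u + (c, d)).1 + (u + (c, d)).2 = (u + (a, b)).1 + (u + (a, b)).2 := by simp; omega
  have hd := (h.hasDerivAt_limitChar_zero hr).sub (h.hasDerivAt_limitChar_zero hb)
  rw [hrb, ← sub_mul, ← Complex.ofReal_sub, ← mul_sub] at hd
  have hne : ((growthConst a b c ((u + (a, b)).1 + (u + (a, b)).2) *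
      (u₂ a b c (u + (a, b)) - u₂ a b c (u + (c, d))) : ℝ) : ℂ) * Complex.I ≠ 0 := by
    refine mul_ne_zero (Complex.ofReal_ne_zero.2 (mul_ne_zero (h.growthConst_pos hr).ne' ?_))
      Complex.I_ne_zero
    rw [h.u₂_add_red, h.u₂_add_black]
    have p1 : 0 < b * ((a : ℝ) - c) / ((a : ℝ) + b) :=
      div_pos (mul_pos h.b_pos h.drift_pos) h.balance_pos
    have p2 : 0 < c * ((a : ℝ) - c) / ((a : ℝ) + b) :=
      div_pos (mul_pos h.c_pos h.drift_pos) h.balance_pos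
    linarith
  have hev := hd.eventually_ne (c := 0) hne
  filter_upwards [hev] with t ht
  have ht' : limitChar a b c d (u + (a, b)) t ≠ limitChar a b c d (u + (c, d)) t :=
    sub_ne_zero.1 ht
  rw [h.limitChar_eq (by omega) t]
  have p1 : (0 : ℝ) < u.1 := by exact_mod_cast h1
  have p2 : (0 : ℝ) < u.2 := by exact_mod_cast h2
  exact norm_combo_lt_of_ne (h.norm_limitChar_le_one hr t) (h.norm_limitChar_le_one hb t) ht'
    (by positivity) (by positivity) (proportion_add_eq_one (by omega))

/-- All four entries of the matrix are positive, so one drawing leads to an urn with both colors. -/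
theorem eventually_norm_limitChar_lt_one {u : ℕ × ℕ} (hu : 0 < u.1 + u.2) :
    ∀ᶠ t in 𝓝[≠] 0, ‖limitChar a b c d u t‖ < 1 := by
  have ha := h.a_pos
  have hd := h.d_pos
  have hb := Nat.pos_of_ne_zero h.b_ne_zero
  have hc := Nat.pos_of_ne_zero h.c_ne_zero
  filter_upwards [h.eventually_norm_limitChar_lt_one_of_pos (u := u + (a, b)) (by simp; omega)
    (by simp; omega), h.eventually_norm_limitChar_lt_one_of_pos (u := u + (c, d)) (by simp; omega)
    (by simp; omega)] with t ht1 ht2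
  have hpos := cast_add_cast_pos hu
  rw [h.limitChar_eq hu t]
  refine (norm_add_le _ _).trans_lt ?_
  rw [norm_smul, norm_smul, Real.norm_of_nonneg (by positivity),
    Real.norm_of_nonneg (by positivity)]
  have hpq := proportion_add_eq_one hu
  set p := (u.1 : ℝ) / ((u.1 : ℝ) + u.2)
  set q := (u.2 : ℝ) / ((u.1 : ℝ) + u.2)
  have hp : 0 ≤ p := by positivity
  have hq : 0 ≤ q := by positivity
  rcases hp.eq_or_lt with hp' | hp' <;> nlinarith

end IsLarge

/-! ### Multiplicativity of the generating series -/

/-- The normalized rising factorial `p (p + 1) ⋯ (p + k - 1) / k!`. -/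
noncomputable def risingRatio (p : ℝ) (k : ℕ) : ℝ := ∏ i ∈ Finset.range k, (p + i) / (i + 1)

theorem risingRatio_succ (p : ℝ) (k : ℕ) :
    risingRatio p (k + 1) = risingRatio p k * ((p + k) / (k + 1)) := Finset.prod_range_succ ..

theorem risingRatio_succ_mul (p : ℝ) (k : ℕ) :
    risingRatio p (k + 1) * (k + 1) = p * risingRatio (p + 1) k := by
  induction k with
  | zero => simp [risingRatio]
  | succ k ih =>
    rw [risingRatio_succ, risingRatio_succ (p + 1), ← mul_assoc, ← ih]
    push_cast
    field_simp
    ring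

theorem risingRatio_add_one_mul (p : ℝ) (k : ℕ) :
    risingRatio (p + 1) k * p = risingRatio p k * (p + k) := by
  rw [mul_comm, ← risingRatio_succ_mul, risingRatio_succ]
  field_simp

theorem risingRatio_one (k : ℕ) : risingRatio 1 k = 1 :=
  Finset.prod_eq_one fun i _ => by rw [add_comm, div_self (by positivity)]

theorem risingRatio_pos {p : ℝ} (hp : 0 < p) (k : ℕ) : 0 < risingRatio p k :=
  Finset.prod_pos fun i _ => by positivity

theorem risingRatio_mono {p : ℝ} (hp : 1 ≤ p) : Monotone (risingRatio p) := by
  refine monotone_nat_of_le_succ fun k => ?_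
  rw [risingRatio_succ]
  refine le_mul_of_one_le_right (risingRatio_pos (by linarith) k).le ?_
  rw [one_le_div (by positivity)]
  linarith

/-- The generating series of the characteristic functions of the urn process started at `u`, with
weights making it multiplicative in `u`. -/
noncomputable def charSeries (a b c d : ℕ) (θ : ℝ) (u : ℕ × ℕ) : PowerSeries ℂ :=
  PowerSeries.mk fun k =>
    (risingRatio (((u.1 : ℝ) + u.2) / ((a : ℝ) + b)) k : ℂ) * charSeq a b c d k θ u

namespace IsLarge

variable {a b c d : ℕ} (h : IsLarge a b c d)
include h

/-- The weights are chosen so that differentiation replaces the drawing probability `x / (x + y)` by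
`x / S`, which is additive in the composition. -/
theorem derivative_charSeries (θ : ℝ) (u : ℕ × ℕ) :
    PowerSeries.derivative ℂ (charSeries a b c d θ u) =
      ((u.1 : ℂ) / ((a : ℂ) + b)) • charSeries a b c d θ (u + (a, b)) +
      ((u.2 : ℂ) / ((a : ℂ) + b)) • charSeries a b c d θ (u + (c, d)) := by
  ext n
  have hS := h.balance_pos
  have hSC : (a : ℂ) + b ≠ 0 := by exact_mod_cast hS.ne'
  set s := (u.1 : ℝ) + u.2 with hs
  have e1 : (((u + (a, b)).1 : ℝ) + (u + (a, b)).2) / ((a : ℝ) + b) = s / ((a : ℝ) + b) + 1 := by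
    simp only [Prod.fst_add, Prod.snd_add, Nat.cast_add]; field_simp; rw [hs]; ring
  have e2 : (((u + (c, d)).1 : ℝ) + (u + (c, d)).2) / ((a : ℝ) + b) = s / ((a : ℝ) + b) + 1 := by
    simp only [Prod.fst_add, Prod.snd_add, Nat.cast_add]; field_simp; rw [hs]
    linarith [h.balanced_real]
  have e3 : (risingRatio (s / ((a : ℝ) + b)) (n + 1) : ℂ) * ((n : ℂ) + 1) =
      (s : ℂ) / ((a : ℂ) + b) * (risingRatio (s / ((a : ℝ) + b) + 1) n : ℂ) := by
    have := risingRatio_succ_mul (s / ((a : ℝ) + b)) n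
    exact_mod_cast this
  rw [PowerSeries.coeff_derivative]
  simp only [charSeries, map_add, map_smul, PowerSeries.coeff_mk, smul_eq_mul, e1, e2, ← hs]
  rw [mul_right_comm, e3, charSeq_succ, ← hs]
  simp only [Complex.real_smul]
  -- For the empty urn the drawing probabilities are `0 / 0 = 0`, and both sides vanish.
  rcases eq_or_ne s 0 with h0 | h0
  · have hx : (u.1 : ℝ) = 0 := by
      linarith [(u.1.cast_nonneg : (0 : ℝ) ≤ u.1), (u.2.cast_nonneg : (0 : ℝ) ≤ u.2)]
    have hy : (u.2 : ℝ) = 0 := by linarith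
    have hx' : (u.1 : ℂ) = 0 := by exact_mod_cast hx
    have hy' : (u.2 : ℂ) = 0 := by exact_mod_cast hy
    simp [hx', hy', h0]
  · have h0' : (s : ℂ) ≠ 0 := by exact_mod_cast h0
    push_cast
    field_simp

/-- Constant terms are multiplicative because `u₂` is additive. By Leibniz and additivity of `x / S`
and `y / S`, the products satisfy the same differential system, which determines the coefficients
recursively. -/
theorem charSeries_add (θ : ℝ) (v w : ℕ × ℕ) :
    charSeries a b c d θ (v + w) = charSeries a b c d θ v * charSeries a b c d θ w := by
  ext n
  induction n generalizing v w with
  | zero =>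
    simp [charSeries, PowerSeries.coeff_mul, risingRatio, charSeq, wave, ← Complex.exp_add]
    rw [← add_mul, ← mul_add]
    congr 3
    simp only [u₂, Prod.fst_add, Prod.snd_add, Nat.cast_add]
    push_cast
    ring
  | succ n ih =>
    have hn : ((n : ℂ) + 1) ≠ 0 := by exact_mod_cast n.succ_ne_zero
    refine mul_right_cancel₀ hn ?_
    rw [← PowerSeries.coeff_derivative, ← PowerSeries.coeff_derivative, Derivation.leibniz,
      h.derivative_charSeries, h.derivative_charSeries, h.derivative_charSeries]
    simp only [smul_eq_mul, mul_add, mul_smul_comm, map_add, map_smul, ← ih]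
    rw [← add_assoc v w (a, b), ← add_assoc v w (c, d), ← add_assoc w v (a, b),
      ← add_assoc w v (c, d), add_comm w v]
    simp only [Prod.fst_add, Prod.snd_add, Nat.cast_add]
    ring

/-- Comparison of coefficients: the weights of `w` are all `1`, those of `v` increase as `p ≥ 1`,
and the weight on the left is `(p + n) / p` times the largest of them, with `p + n ≥ n + 1`. -/
theorem norm_charSeq_add_le {p : ℝ} (hp : 1 ≤ p) {v w : ℕ × ℕ}
    (hv : (v.1 : ℝ) + v.2 = p * ((a : ℝ) + b)) (hw : w.1 + w.2 = a + b) (n : ℕ) (θ : ℝ) :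
    ‖charSeq a b c d n θ (v + w)‖ ≤ p * ((1 / ((n + 1 : ℕ) : ℝ)) * ∑ k ∈ Finset.range (n + 1),
      ‖charSeq a b c d k θ v‖ * ‖charSeq a b c d (n - k) θ w‖) := by
  have hS := h.balance_pos
  have hp0 : 0 < p := by linarith
  have hw' : (w.1 : ℝ) + w.2 = (a : ℝ) + b := by exact_mod_cast hw
  have e1 : ((v.1 : ℝ) + v.2) / ((a : ℝ) + b) = p := by rw [hv]; field_simp
  have e2 : ((w.1 : ℝ) + w.2) / ((a : ℝ) + b) = 1 := by rw [hw', div_self hS.ne']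
  have e3 : (((v + w).1 : ℝ) + (v + w).2) / ((a : ℝ) + b) = p + 1 := by
    rw [← e1, ← e2]; simp only [Prod.fst_add, Prod.snd_add, Nat.cast_add]; ring
  have key := congrArg (PowerSeries.coeff n) (h.charSeries_add θ v w)
  rw [PowerSeries.coeff_mul, Finset.Nat.sum_antidiagonal_eq_sum_range_succ_mk] at key
  simp only [charSeries, PowerSeries.coeff_mk, e1, e2, e3, risingRatio_one, Complex.ofReal_one,
    one_mul] at key
  set T := ∑ k ∈ Finset.range (n + 1),
      ‖charSeq a b c d k θ v‖ * ‖charSeq a b c d (n - k) θ w‖ with hT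
  have hT0 : 0 ≤ T := Finset.sum_nonneg fun _ _ => by positivity
  have h1 : risingRatio (p + 1) n * ‖charSeq a b c d n θ (v + w)‖ ≤ risingRatio p n * T := by
    have := congrArg norm key
    rw [norm_mul, Complex.norm_of_nonneg (risingRatio_pos (by linarith) n).le] at this
    rw [this, hT, Finset.mul_sum]
    refine (norm_sum_le _ _).trans (Finset.sum_le_sum fun k hk => ?_)
    rw [norm_mul, norm_mul, Complex.norm_of_nonneg (risingRatio_pos hp0 k).le, mul_assoc]
    exact mul_le_mul_of_nonneg_right
      (risingRatio_mono hp (by simpa [Nat.lt_succ_iff] using hk)) (by positivity)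
  have h2 := risingRatio_add_one_mul p n
  have h3 := risingRatio_pos hp0 n
  have h4 : (p + n) * ‖charSeq a b c d n θ (v + w)‖ ≤ p * T := by
    refine le_of_mul_le_mul_left ?_ h3
    calc _ = p * (risingRatio (p + 1) n * ‖charSeq a b c d n θ (v + w)‖) := by
          linear_combination (-‖charSeq a b c d n θ (v + w)‖) * h2
      _ ≤ p * (risingRatio p n * T) := by gcongr
      _ = _ := by ring
  rw [one_div, ← mul_assoc, mul_comm p, mul_assoc, inv_mul_eq_div, le_div_iff₀ (by positivity)]
  refine le_trans ?_ h4
  rw [mul_comm]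
  push_cast
  gcongr ?_ * _
  linarith

end IsLarge

/-! ### From convolution sums to an integral inequality -/

theorem integral_comp_floor (F : ℕ → ℝ) (N : ℕ) :
    ∫ x in (0 : ℝ)..N, F ⌊x⌋₊ = ∑ k ∈ Finset.range N, F k := by
  have hcongr : ∀ k : ℕ, ∀ x ∈ Set.Ioo (k : ℝ) ((k + 1 : ℕ) : ℝ), F k = F ⌊x⌋₊ := by
    intro k x hx
    rw [(Nat.floor_eq_iff ((Nat.cast_nonneg k).trans hx.1.le)).2
      ⟨hx.1.le, by exact_mod_cast hx.2⟩]
  have hint : ∀ k < N, IntervalIntegrable (fun x : ℝ => F ⌊x⌋₊) volume (k : ℕ) (k + 1 : ℕ) := by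
    intro k _
    rw [intervalIntegrable_iff_integrableOn_Ioo_of_le (by simp)]
    exact (integrableOn_const (C := F k) (by simp)).congr_fun (hcongr k) measurableSet_Ioo
  have := intervalIntegral.sum_integral_adjacent_intervals (a := fun k : ℕ => (k : ℝ)) hint
  rw [Nat.cast_zero] at this
  rw [← this]
  refine Finset.sum_congr rfl fun k _ => ?_
  rw [intervalIntegral.integral_of_le (by simp), integral_Ioc_eq_integral_Ioo,
    ← setIntegral_congr_fun measurableSet_Ioo (hcongr k)]
  simp

/-- Writing an average as the integral of a step function makes dominated convergence available. -/
theorem integral_comp_floor_mul (F : ℕ → ℝ) {N : ℕ} (hN : N ≠ 0) :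
    ∫ x in (0 : ℝ)..1, F ⌊(N : ℝ) * x⌋₊ = 1 / (N : ℝ) * ∑ k ∈ Finset.range N, F k := by
  have hN' : (N : ℝ) ≠ 0 := by exact_mod_cast hN
  rw [intervalIntegral.integral_comp_mul_left (fun x => F ⌊x⌋₊) hN', mul_zero, mul_one,
    integral_comp_floor, smul_eq_mul, one_div]

namespace IsLarge

variable {a b c d : ℕ} (h : IsLarge a b c d)
include h

theorem tendsto_charSeq_of_tendsto_div {u : ℕ × ℕ} (hu : 0 < u.1 + u.2) (t : ℝ) {k : ℕ → ℕ}
    {s : ℝ} (hs : 0 < s) (hk : Tendsto (fun n : ℕ => (k n : ℝ) / n) atTop (𝓝 s)) :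
    Tendsto (fun n : ℕ => charSeq a b c d (k n) (t / (n : ℝ) ^ ratio a b c) u) atTop
      (𝓝 (limitChar a b c d u (t * s ^ ratio a b c))) := by
  refine h.tendsto_charSeq hu ?_ ?_
  · rw [← tendsto_natCast_atTop_iff (R := ℝ)]
    refine (hk.pos_mul_atTop hs tendsto_natCast_atTop_atTop).congr' ?_
    filter_upwards [eventually_gt_atTop 0] with n hn
    have : (0 : ℝ) < n := by exact_mod_cast hn
    field_simp
  · refine ((hk.rpow_const (.inl hs.ne')).const_mul t).congr fun n => ?_
    rw [Real.div_rpow (by positivity) (by positivity)]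
    ring

theorem norm_limitChar_add_le {p : ℝ} (hp : 1 ≤ p) {v w : ℕ × ℕ}
    (hv : (v.1 : ℝ) + v.2 = p * ((a : ℝ) + b)) (hw : w.1 + w.2 = a + b) (t : ℝ) :
    ‖limitChar a b c d (v + w) t‖ ≤ p * ∫ s in (0 : ℝ)..1,
      ‖limitChar a b c d v (t * s ^ ratio a b c)‖ *
        ‖limitChar a b c d w (t * (1 - s) ^ ratio a b c)‖ := by
  have hS := h.balance_pos
  have hv0 : 0 < v.1 + v.2 := by
    have : (0 : ℝ) < (v.1 : ℝ) + v.2 := by rw [hv]; positivity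
    exact_mod_cast this
  have hw0 : 0 < w.1 + w.2 := by rw [hw]; exact_mod_cast hS
  set θ : ℕ → ℝ := fun n => t / (n : ℝ) ^ ratio a b c
  have hl := (h.tendsto_charSeq_div_rpow (u := v + w) (by simp; omega) t).norm
  refine le_of_tendsto_of_tendsto' hl ?_ fun n => h.norm_charSeq_add_le hp hv hw n (θ n)
  refine Tendsto.const_mul p ?_
  simp_rw [← integral_comp_floor_mul _ (Nat.succ_ne_zero _)]
  refine intervalIntegral.tendsto_integral_filter_of_dominated_convergence (fun _ => 1)
    (.of_forall fun n => ?_) (.of_forall fun n => .of_forall fun x _ => ?_) (by simp) ?_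
  · exact (Measurable.of_discrete (f := fun k : ℕ => ‖charSeq a b c d k (θ n) v‖ *
      ‖charSeq a b c d (n - k) (θ n) w‖).comp
      (Nat.measurable_floor.comp (measurable_const_mul _))).aestronglyMeasurable
  · rw [norm_mul, norm_norm, norm_norm]
    exact mul_le_one₀ (norm_charSeq_le h.balanced _ _ hv0) (norm_nonneg _)
      (norm_charSeq_le h.balanced _ _ hw0)
  · have hne : ∀ᵐ x : ℝ, x ≠ 1 := by simp [ae_iff]
    filter_upwards [hne] with s hs1 hs
    rw [Set.uIoc_of_le zero_le_one] at hs
    have hs1 : s < 1 := lt_of_le_of_ne hs.2 hs1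
    have hk : Tendsto (fun n : ℕ => (⌊((n + 1 : ℕ) : ℝ) * s⌋₊ : ℝ) / n) atTop (𝓝 s) := by
      have h1 := (tendsto_nat_floor_mul_div_atTop hs.1.le).comp
        (tendsto_natCast_atTop_atTop.comp (tendsto_add_atTop_nat 1) :
          Tendsto (fun n : ℕ => ((n + 1 : ℕ) : ℝ)) atTop atTop)
      have h2 := (tendsto_const_nhds (x := (1 : ℝ))).add
        (tendsto_one_div_atTop_nhds_zero_nat (𝕜 := ℝ))
      have h3 := h1.mul h2
      rw [add_zero, mul_one] at h3
      refine h3.congr' ?_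
      filter_upwards [eventually_gt_atTop 0] with n hn
      have : (0 : ℝ) < n := by exact_mod_cast hn
      simp only [Function.comp]
      rw [mul_comm s]
      push_cast
      field_simp
    have hk' : Tendsto (fun n : ℕ => ((n - ⌊((n + 1 : ℕ) : ℝ) * s⌋₊ : ℕ) : ℝ) / n) atTop
        (𝓝 (1 - s)) := by
      refine (tendsto_const_nhds.sub hk).congr' ?_
      filter_upwards [eventually_gt_atTop 0] with n hn
      have hn' : (0 : ℝ) < n := by exact_mod_cast hn
      have hle : ⌊((n + 1 : ℕ) : ℝ) * s⌋₊ ≤ n := by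
        refine Nat.lt_succ_iff.1 ((Nat.floor_lt (mul_nonneg (by positivity) hs.1.le)).2 ?_)
        exact mul_lt_of_lt_one_right (by positivity) hs1
      rw [Nat.cast_sub hle]
      field_simp
    exact (h.tendsto_charSeq_of_tendsto_div hv0 t hs.1 hk).norm.mul
      (h.tendsto_charSeq_of_tendsto_div hw0 t (by linarith) hk').norm

end IsLarge

end PolyaUrn

/-! ### A convolution inequality treated by Laplace transform -/

section Laplace

theorem setIntegral_Ioi_pos {f : ℝ → ℝ} (hf : Continuous f) (hnn : ∀ x, 0 ≤ f x)
    (hi : IntegrableOn f (Set.Ioi 0)) {r : ℝ} (hr : 0 < r) (hfr : 0 < f r) :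
    0 < ∫ x in Set.Ioi 0, f x := by
  rw [setIntegral_pos_iff_support_of_nonneg_ae (.of_forall hnn) hi]
  exact (hf.isOpen_support.inter isOpen_Ioi).measure_pos _ ⟨r, hfr.ne', hr⟩

variable {χ : ℝ → ℝ} (hc : Continuous χ) (h0 : ∀ x, 0 ≤ χ x) (h1 : ∀ x, χ x ≤ 1)
include hc h0 h1

theorem integrableOn_exp_neg_mul_mul {z : ℝ} (hz : 0 < z) :
    IntegrableOn (fun x => Real.exp (-z * x) * χ x) (Set.Ioi 0) := by
  refine (exp_neg_integrableOn_Ioi 0 hz).mono' (by fun_prop) (.of_forall fun x => ?_)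
  rw [norm_mul, Real.norm_of_nonneg (Real.exp_pos _).le, Real.norm_of_nonneg (h0 x)]
  exact mul_le_of_le_one_right (Real.exp_pos _).le (h1 x)

theorem hasDerivAt_laplace {z : ℝ} (hz : 0 < z) :
    IntegrableOn (fun x => -x * (Real.exp (-z * x) * χ x)) (Set.Ioi 0) ∧
    HasDerivAt (fun z => ∫ x in Set.Ioi 0, Real.exp (-z * x) * χ x)
      (∫ x in Set.Ioi 0, -x * (Real.exp (-z * x) * χ x)) z := by
  have hb : IntegrableOn (fun x : ℝ => x * Real.exp (-(z / 2) * x)) (Set.Ioi 0) := by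
    have := integrableOn_rpow_mul_exp_neg_mul_rpow (p := 1) (s := 1) (b := z / 2) (by norm_num)
      one_pos (by positivity)
    simpa using this
  refine hasDerivAt_integral_of_dominated_loc_of_deriv_le
    (F := fun y x => Real.exp (-y * x) * χ x) (F' := fun y x => -x * (Real.exp (-y * x) * χ x))
    (μ := volume.restrict (Set.Ioi 0)) (Ioi_mem_nhds (half_lt_self hz))
    (.of_forall fun y => ?_) (integrableOn_exp_neg_mul_mul hc h0 h1 hz) ?_
    (bound := fun x => x * Real.exp (-(z / 2) * x)) ?_ hb (.of_forall fun x y _ => ?_)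
  · fun_prop
  · fun_prop
  · refine (ae_restrict_iff' measurableSet_Ioi).2 (.of_forall fun x hx y hy => ?_)
    have hx' : (0 : ℝ) < x := hx
    have hy' : z / 2 < y := hy
    rw [norm_mul, norm_mul, norm_neg, Real.norm_of_nonneg hx'.le,
      Real.norm_of_nonneg (Real.exp_pos _).le, Real.norm_of_nonneg (h0 x)]
    refine mul_le_mul_of_nonneg_left ((mul_le_of_le_one_right (Real.exp_pos _).le (h1 x)).trans ?_)
      hx'.le
    rw [Real.exp_le_exp]
    nlinarith
  · have e : HasDerivAt (fun y : ℝ => -y * x) (-x) y := by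
      simpa using ((hasDerivAt_id y).neg).mul_const x
    exact (e.exp.mul_const (χ x)).congr_deriv (by ring)

/-- A continuous function with values in `[0, 1]`, somewhere smaller than `1`, satisfying the
convolution inequality `r χ(r) ≤ (χ * χ)(r)` is integrable on the half-line. -/
theorem exists_integral_le_of_mul_le_convolution {r₀ r₁ : ℝ} (hr₀ : 0 < r₀) (hχ₀ : 0 < χ r₀)
    (hr₁ : 0 < r₁) (hχ₁ : χ r₁ < 1)
    (hconv : ∀ r, 0 < r → r * χ r ≤ ∫ s in (0 : ℝ)..r, χ s * χ (r - s)) :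
    ∃ C, ∀ R, 0 < R → ∫ s in (0 : ℝ)..R, χ s ≤ C := by
  set X : ℝ → ℝ := fun z => ∫ x in Set.Ioi 0, Real.exp (-z * x) * χ x with hX
  have hint := fun z (hz : 0 < z) => integrableOn_exp_neg_mul_mul hc h0 h1 hz
  have hnn : ∀ z x, 0 ≤ Real.exp (-z * x) * χ x := fun z x => mul_nonneg (Real.exp_pos _).le (h0 x)
  have hXpos : ∀ z, 0 < z → 0 < X z := fun z hz =>
    setIntegral_Ioi_pos (by fun_prop) (hnn z) (hint z hz) hr₀ (mul_pos (Real.exp_pos _) hχ₀)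
  have hderiv := fun z (hz : 0 < z) => hasDerivAt_laplace hc h0 h1 hz
  -- The Laplace transform of the convolution inequality is `-X' ≤ X²`.
  have hsq : ∀ z, 0 < z → -(∫ x in Set.Ioi 0, -x * (Real.exp (-z * x) * χ x)) ≤ X z ^ 2 := by
    intro z hz
    have key := integral_posConvolution (hint z hz) (hint z hz) (ContinuousLinearMap.mul ℝ ℝ)
    have key2 := integrable_posConvolution (hint z hz) (hint z hz) (ContinuousLinearMap.mul ℝ ℝ)
    simp only [ContinuousLinearMap.mul_apply'] at key
    rw [sq, hX]
    simp only
    rw [← key, ← integral_neg]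
    refine setIntegral_mono_on (hderiv z hz).1.neg ?_ measurableSet_Ioi fun x hx => ?_
    · rw [← integrable_indicator_iff measurableSet_Ioi]
      exact key2
    · have e : ∀ t, Real.exp (-z * t) * χ t * (Real.exp (-z * (x - t)) * χ (x - t)) =
          Real.exp (-z * x) * (χ t * χ (x - t)) := by
        intro t
        rw [show -z * x = -z * t + -z * (x - t) by ring, Real.exp_add]
        ring
      simp only [e, intervalIntegral.integral_const_mul]
      calc -(-x * (Real.exp (-z * x) * χ x)) = Real.exp (-z * x) * (x * χ x) := by ring
        _ ≤ _ := mul_le_mul_of_nonneg_left (hconv x hx) (Real.exp_pos _).le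
  have hX1 : X 1 < 1 := by
    have hi : IntegrableOn (fun x => Real.exp (-1 * x) * (1 - χ x)) (Set.Ioi 0) :=
      integrableOn_exp_neg_mul_mul (continuous_const.sub hc) (fun x => sub_nonneg.2 (h1 x))
        (fun x => sub_le_self _ (h0 x)) one_pos
    have h2 := setIntegral_Ioi_pos (f := fun x => Real.exp (-1 * x) * (1 - χ x)) (by fun_prop)
      (fun x => mul_nonneg (Real.exp_pos _).le (sub_nonneg.2 (h1 x))) hi hr₁
      (mul_pos (Real.exp_pos _) (sub_pos.2 hχ₁))
    have h3 := integral_add (hint 1 one_pos) hi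
    have h4 : ∫ x in Set.Ioi (0 : ℝ), Real.exp (-1 * x) * χ x +
        Real.exp (-1 * x) * (1 - χ x) = 1 := by
      refine (integral_congr_ae (.of_forall fun x => ?_)).trans integral_exp_neg_Ioi_zero
      simp only [neg_one_mul]
      ring
    rw [h4] at h3
    simp only [hX]
    linarith
  -- The derivative of `z - 1 / X` is `1 + X' / X² ≥ 0`.
  have hmono : MonotoneOn (fun z => z - (X z)⁻¹) (Set.Ioi 0) := by
    have hd : ∀ z, 0 < z → HasDerivAt (fun z => z - (X z)⁻¹)
        (1 - -(∫ x in Set.Ioi 0, -x * (Real.exp (-z * x) * χ x)) / X z ^ 2) z := fun z hz =>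
      (hasDerivAt_id z).sub ((hderiv z hz).2.inv (hXpos z hz).ne')
    refine monotoneOn_of_deriv_nonneg (convex_Ioi 0)
      (fun z hz => (hd z hz).continuousAt.continuousWithinAt)
      (fun z hz => (hd z (interior_subset hz)).differentiableAt.differentiableWithinAt)
      fun z hz => ?_
    have hz' : 0 < z := interior_subset hz
    rw [(hd z hz').deriv, sub_nonneg, div_le_one (pow_pos (hXpos z hz') 2)]
    exact hsq z hz'
  set κ := (X 1)⁻¹ - 1 with hκ
  have hκ0 : 0 < κ := sub_pos.2 ((one_lt_inv₀ (hXpos 1 one_pos)).2 hX1)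
  -- Comparison with `z = 1` gives `1 / X z ≥ z + κ`, and `κ > 0` because `X 1 < 1`.
  have hbound : ∀ z, 0 < z → z ≤ 1 → X z ≤ κ⁻¹ := by
    intro z hz hz1
    have := hmono hz (Set.mem_Ioi.2 one_pos) hz1
    simp only at this
    rw [le_inv_comm₀ (hXpos z hz) hκ0]
    linarith
  refine ⟨Real.exp 1 * κ⁻¹, fun R hR => ?_⟩
  -- On `(0, R]` this choice gives `exp (-z x) ≥ exp (-1)`, whence the factor `exp 1`.
  set z := min 1 R⁻¹ with hz
  have hz0 : 0 < z := lt_min one_pos (inv_pos.2 hR)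
  have hzR : z * R ≤ 1 := by
    calc z * R ≤ R⁻¹ * R := mul_le_mul_of_nonneg_right (min_le_right _ _) hR.le
      _ = 1 := inv_mul_cancel₀ hR.ne'
  refine le_trans ?_ (mul_le_mul_of_nonneg_left (hbound z hz0 (min_le_left _ _))
    (Real.exp_pos 1).le)
  rw [intervalIntegral.integral_of_le hR.le, hX, ← integral_const_mul]
  refine (setIntegral_mono_on (hc.integrableOn_Ioc) (((hint z hz0).mono_set
    Set.Ioc_subset_Ioi_self).const_mul (Real.exp 1)) measurableSet_Ioc fun x hx => ?_).trans
    (setIntegral_mono_set ((hint z hz0).const_mul _)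
      (.of_forall fun x => mul_nonneg (Real.exp_pos _).le (hnn z x))
      Set.Ioc_subset_Ioi_self.eventuallyLE)
  rw [← mul_assoc, ← Real.exp_add]
  refine le_mul_of_one_le_left (h0 x) (Real.one_le_exp ?_)
  have : z * x ≤ z * R := mul_le_mul_of_nonneg_left hx.2 hz0.le
  linarith

end Laplace

/-! ### Decay and integrability of the limit characteristic function -/

namespace PolyaUrn

/-- The largest modulus of the limit characteristic functions of the urns with `a + b` balls. -/
noncomputable def maxChar (a b c d : ℕ) (t : ℝ) : ℝ :=
  (Finset.HasAntidiagonal.antidiagonal (a + b)).sup' ⟨(a, b), by simp⟩ fun u => ‖limitChar a b c d u t‖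

theorem norm_limitChar_le_maxChar {a b c d : ℕ} {u : ℕ × ℕ} (hu : u.1 + u.2 = a + b) (t : ℝ) :
    ‖limitChar a b c d u t‖ ≤ maxChar a b c d t :=
  Finset.le_sup' (fun u => ‖limitChar a b c d u t‖) (Finset.HasAntidiagonal.mem_antidiagonal.2 hu)

theorem maxChar_nonneg (a b c d : ℕ) (t : ℝ) : 0 ≤ maxChar a b c d t :=
  (norm_nonneg _).trans (norm_limitChar_le_maxChar (u := (a, b)) rfl t)

namespace IsLarge

variable {a b c d : ℕ} (h : IsLarge a b c d)
include h

theorem balance_pos_nat : 0 < a + b := by exact_mod_cast h.balance_pos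

theorem total_pos {u : ℕ × ℕ} (hu : u.1 + u.2 = a + b) : 0 < u.1 + u.2 :=
  hu ▸ h.balance_pos_nat

theorem continuous_maxChar : Continuous (maxChar a b c d) :=
  Continuous.finset_sup'_apply _ fun _ hu =>
    (h.continuous_limitChar (h.total_pos (Finset.HasAntidiagonal.mem_antidiagonal.1 hu))).norm

theorem maxChar_le_one (t : ℝ) : maxChar a b c d t ≤ 1 :=
  Finset.sup'_le _ _ fun _ hu =>
    h.norm_limitChar_le_one (h.total_pos (Finset.HasAntidiagonal.mem_antidiagonal.1 hu)) t

theorem maxChar_zero : maxChar a b c d 0 = 1 := by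
  refine le_antisymm (h.maxChar_le_one 0) ?_
  have := norm_limitChar_le_maxChar (a := a) (b := b) (c := c) (d := d) (u := (a, b)) rfl 0
  rwa [h.limitChar_zero (h.total_pos rfl), norm_one] at this

theorem eventually_maxChar_lt_one : ∀ᶠ t in 𝓝[≠] 0, maxChar a b c d t < 1 := by
  have := (Filter.eventually_all_finset (Finset.HasAntidiagonal.antidiagonal (a + b))).2
    fun u hu => h.eventually_norm_limitChar_lt_one
      (h.total_pos (Finset.HasAntidiagonal.mem_antidiagonal.1 hu))
  exact this.mono fun t ht => (Finset.sup'_lt_iff _).2 ht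

/-- Bounds for the limit characteristic functions of larger urns, transferred by one drawing. -/
theorem norm_limitChar_le_of_step {u : ℕ × ℕ} (hu : 0 < u.1 + u.2) {t C : ℝ}
    (hr : ‖limitChar a b c d (u + (a, b)) t‖ ≤ C) (hb : ‖limitChar a b c d (u + (c, d)) t‖ ≤ C) :
    ‖limitChar a b c d u t‖ ≤ C := by
  rw [h.limitChar_eq hu t]
  refine (norm_add_le _ _).trans ?_
  rw [norm_smul, norm_smul, Real.norm_of_nonneg (by positivity),
    Real.norm_of_nonneg (by positivity)]
  calc _ ≤ (u.1 : ℝ) / ((u.1 : ℝ) + u.2) * C + (u.2 : ℝ) / ((u.1 : ℝ) + u.2) * C := by gcongr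
    _ = C := by rw [← add_mul, proportion_add_eq_one hu, one_mul]

theorem continuous_mul_rpow (t : ℝ) : Continuous fun s : ℝ => t * s ^ ratio a b c :=
  continuous_const.mul (Real.continuous_rpow_const h.ratio_pos.le)

/-- Each row of the matrix is itself an urn of `S` balls, so one drawing turns an urn of `S` balls
into a sum of two such urns, and the inequality applies with `p = 1`. -/
theorem maxChar_le_integral (t : ℝ) :
    maxChar a b c d t ≤ ∫ s in (0 : ℝ)..1, maxChar a b c d (t * s ^ ratio a b c) *
      maxChar a b c d (t * (1 - s) ^ ratio a b c) := by
  have key : ∀ v w : ℕ × ℕ, v.1 + v.2 = a + b → w.1 + w.2 = a + b →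
      ‖limitChar a b c d (v + w) t‖ ≤ ∫ s in (0 : ℝ)..1, maxChar a b c d (t * s ^ ratio a b c) *
      maxChar a b c d (t * (1 - s) ^ ratio a b c) := by
    intro v w hv hw
    have := h.norm_limitChar_add_le le_rfl (v := v) (w := w)
      (by rw [one_mul]; exact_mod_cast hv) hw t
    rw [one_mul] at this
    have hcont := h.continuous_mul_rpow t
    have hcont' : Continuous fun s : ℝ => t * (1 - s) ^ ratio a b c :=
      hcont.comp (continuous_const.sub continuous_id)
    refine this.trans (intervalIntegral.integral_mono_on zero_le_one
      (Continuous.intervalIntegrable ?_ _ _) (Continuous.intervalIntegrable ?_ _ _) fun s _ =>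
      mul_le_mul (norm_limitChar_le_maxChar hv _) (norm_limitChar_le_maxChar hw _)
        (norm_nonneg _) (maxChar_nonneg ..))
    · exact ((h.continuous_limitChar (h.total_pos hv)).comp hcont).norm.mul
        ((h.continuous_limitChar (h.total_pos hw)).comp hcont').norm
    · exact (h.continuous_maxChar.comp hcont).mul (h.continuous_maxChar.comp hcont')
  refine Finset.sup'_le _ _ fun u hu => ?_
  have hu := Finset.HasAntidiagonal.mem_antidiagonal.1 hu
  exact h.norm_limitChar_le_of_step (h.total_pos hu) (key u (a, b) hu rfl)
    (key u (c, d) hu h.balanced.symm)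

/-- With `t = r ^ σ`, the substitution `s ↦ r s` turns the integral inequality into the convolution
inequality for `maxChar (s ^ σ)`. -/
theorem exists_integral_maxChar_le :
    ∃ C, ∀ R, 0 < R → ∫ s in (0 : ℝ)..R, maxChar a b c d (s ^ ratio a b c) ≤ C := by
  have hσ := h.ratio_pos
  have hpow : Continuous fun s : ℝ => s ^ ratio a b c := Real.continuous_rpow_const hσ.le
  have hc : Continuous fun s : ℝ => maxChar a b c d (s ^ ratio a b c) :=
    h.continuous_maxChar.comp hpow
  have hpos : ∃ r₀, 0 < r₀ ∧ 0 < maxChar a b c d (r₀ ^ ratio a b c) := by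
    have : ∀ᶠ r in 𝓝[>] (0 : ℝ), 0 < maxChar a b c d (r ^ ratio a b c) :=
      (hc.continuousAt.eventually (lt_mem_nhds (by
        simp [Real.zero_rpow hσ.ne', h.maxChar_zero]))).filter_mono nhdsWithin_le_nhds
    obtain ⟨r, hr, hr0⟩ := (this.and self_mem_nhdsWithin).exists
    exact ⟨r, hr0, hr⟩
  have hlt : ∃ r₁, 0 < r₁ ∧ maxChar a b c d (r₁ ^ ratio a b c) < 1 := by
    have : ∀ᶠ t in 𝓝[>] (0 : ℝ), maxChar a b c d t < 1 :=
      h.eventually_maxChar_lt_one.filter_mono (nhdsWithin_mono _ fun t ht => ne_of_gt ht)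
    obtain ⟨t, ht, ht0⟩ := (this.and self_mem_nhdsWithin).exists
    have ht0' : (0 : ℝ) < t := ht0
    refine ⟨t ^ (ratio a b c)⁻¹, Real.rpow_pos_of_pos ht0' _, ?_⟩
    rwa [Real.rpow_inv_rpow ht0'.le hσ.ne']
  obtain ⟨r₀, hr₀, hχ₀⟩ := hpos
  obtain ⟨r₁, hr₁, hχ₁⟩ := hlt
  refine exists_integral_le_of_mul_le_convolution hc (fun _ => maxChar_nonneg ..)
    (fun _ => h.maxChar_le_one _) hr₀ hχ₀ hr₁ hχ₁ fun r hr => ?_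
  refine (mul_le_mul_of_nonneg_left (h.maxChar_le_integral _) hr.le).trans (le_of_eq ?_)
  have := intervalIntegral.smul_integral_comp_mul_left (a := 0) (b := 1) (fun s =>
    maxChar a b c d (s ^ ratio a b c) * maxChar a b c d ((r - s) ^ ratio a b c)) r
  rw [mul_zero, mul_one, smul_eq_mul] at this
  rw [← this]
  congr 1
  refine intervalIntegral.integral_congr fun s hs => ?_
  rw [Set.uIcc_of_le zero_le_one] at hs
  rw [← Real.mul_rpow hr.le hs.1, ← Real.mul_rpow hr.le (sub_nonneg.2 hs.2), mul_sub, mul_one]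

/-- One factor of the product is bounded by `1`. With `r = t ^ (1/σ)` the other integrates to at
most `C / r`, by the uniform bound on the integrals of `maxChar`. -/
theorem exists_norm_limitChar_le_of_le {u : ℕ × ℕ} (hu : a + b ≤ u.1 + u.2) :
    ∃ C, ∀ t, 0 < t → ‖limitChar a b c d u t‖ ≤ C * t ^ (-(ratio a b c)⁻¹) := by
  obtain ⟨C, hC⟩ := h.exists_integral_maxChar_le
  have hσ := h.ratio_pos
  have hS := h.balance_pos
  have hu' : (a : ℝ) + b ≤ (u.1 : ℝ) + u.2 := by exact_mod_cast hu
  set p := ((u.1 : ℝ) + u.2) / ((a : ℝ) + b) with hp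
  have hp1 : 1 ≤ p := by rwa [hp, one_le_div hS]
  have hup : (u.1 : ℝ) + u.2 = p * ((a : ℝ) + b) := by rw [hp]; field_simp
  have hu0 : 0 < u.1 + u.2 := h.balance_pos_nat.trans_le hu
  refine ⟨p * C, fun t ht => ?_⟩
  set r := t ^ (ratio a b c)⁻¹ with hr
  have hr0 : 0 < r := Real.rpow_pos_of_pos ht _
  have htr : t = r ^ ratio a b c := by rw [hr, Real.rpow_inv_rpow ht.le hσ.ne']
  rw [Real.rpow_neg ht.le, ← hr]
  have key : ∀ w : ℕ × ℕ, w.1 + w.2 = a + b →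
      ‖limitChar a b c d (u + w) t‖ ≤ p * C * r⁻¹ := by
    intro w hw
    refine (h.norm_limitChar_add_le hp1 hup hw t).trans ?_
    rw [mul_assoc]
    refine mul_le_mul_of_nonneg_left ?_ (by linarith)
    have hcont := h.continuous_mul_rpow t
    have hcont' : Continuous fun s : ℝ => t * (1 - s) ^ ratio a b c :=
      hcont.comp (continuous_const.sub continuous_id)
    have h1 : ∫ s in (0 : ℝ)..1, ‖limitChar a b c d u (t * s ^ ratio a b c)‖ *
        ‖limitChar a b c d w (t * (1 - s) ^ ratio a b c)‖ ≤
        ∫ s in (0 : ℝ)..1, maxChar a b c d (t * (1 - s) ^ ratio a b c) := by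
      refine intervalIntegral.integral_mono_on zero_le_one
        (Continuous.intervalIntegrable ?_ _ _) (Continuous.intervalIntegrable ?_ _ _) fun s _ => ?_
      · exact ((h.continuous_limitChar hu0).comp hcont).norm.mul
          ((h.continuous_limitChar (h.total_pos hw)).comp hcont').norm
      · exact h.continuous_maxChar.comp hcont'
      · exact (mul_le_of_le_one_left (norm_nonneg _) (h.norm_limitChar_le_one hu0 _)).trans
          (norm_limitChar_le_maxChar hw _)
    refine h1.trans ?_
    have h2 := intervalIntegral.integral_comp_sub_left (a := 0) (b := 1)
      (fun s => maxChar a b c d (t * s ^ ratio a b c)) 1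
    rw [sub_self, sub_zero] at h2
    rw [h2]
    have h3 := intervalIntegral.smul_integral_comp_mul_left (a := 0) (b := 1) (fun s =>
      maxChar a b c d (s ^ ratio a b c)) r
    rw [mul_zero, mul_one, smul_eq_mul] at h3
    rw [← div_eq_mul_inv, le_div_iff₀ hr0, mul_comm]
    refine le_trans (le_of_eq ?_) (hC r hr0)
    rw [← h3]
    congr 1
    refine intervalIntegral.integral_congr fun s hs => ?_
    rw [Set.uIcc_of_le zero_le_one] at hs
    rw [Real.mul_rpow hr0.le hs.1, ← htr]
  exact h.norm_limitChar_le_of_step hu0 (key (a, b) rfl) (key (c, d) h.balanced.symm)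

/-- One drawing brings any urn above `S` balls. -/
theorem exists_norm_limitChar_le {u : ℕ × ℕ} (hu : 0 < u.1 + u.2) :
    ∃ C, ∀ t, 0 < t → ‖limitChar a b c d u t‖ ≤ C * t ^ (-(ratio a b c)⁻¹) := by
  obtain ⟨C₁, hC₁⟩ := h.exists_norm_limitChar_le_of_le (u := u + (a, b)) (by simp; omega)
  obtain ⟨C₂, hC₂⟩ := h.exists_norm_limitChar_le_of_le (u := u + (c, d))
    (by have := h.balanced; simp; omega)
  refine ⟨max C₁ C₂, fun t ht => ?_⟩
  have := Real.rpow_pos_of_pos ht (-(ratio a b c)⁻¹)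
  exact h.norm_limitChar_le_of_step hu
    ((hC₁ t ht).trans (mul_le_mul_of_nonneg_right (le_max_left _ _) this.le))
    ((hC₂ t ht).trans (mul_le_mul_of_nonneg_right (le_max_right _ _) this.le))

/-- The exponent satisfies `1/σ > 1`. The decay is known only for positive `t`; evenness of the
modulus supplies the negative side. -/
theorem integrable_of_norm_eq_limitChar {u : ℕ × ℕ} (hu : 0 < u.1 + u.2) {φ : ℝ → ℂ}
    (hφ : Continuous φ) (hneg : ∀ t, ‖φ (-t)‖ = ‖φ t‖)
    (heq : ∀ t, φ t = limitChar a b c d u t) : Integrable φ := by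
  obtain ⟨C, hC⟩ := h.exists_norm_limitChar_le hu
  have hσ : -(ratio a b c)⁻¹ < -1 := by
    have := (one_lt_inv₀ h.ratio_pos).2 h.ratio_lt_one
    linarith
  have h1 : IntegrableOn φ (Set.Ioi 1) := by
    refine ((integrableOn_Ioi_rpow_of_lt hσ one_pos).const_mul C).mono'
      hφ.aestronglyMeasurable ?_
    refine (ae_restrict_iff' measurableSet_Ioi).2 (.of_forall fun t ht => ?_)
    rw [heq]
    exact hC t (zero_lt_one.trans ht)
  have h2 : IntegrableOn φ (Set.Iio (-1)) := by
    have h3 := ((Measure.measurePreserving_neg (volume : Measure ℝ)).integrableOn_comp_preimage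
      (Homeomorph.neg ℝ).measurableEmbedding).2 h1
    have h4 : Neg.neg ⁻¹' Set.Ioi (1 : ℝ) = Set.Iio (-1) := by ext; simp [lt_neg]
    rw [h4] at h3
    exact h3.norm.mono' hφ.aestronglyMeasurable (.of_forall fun t => (hneg t).symm.le)
  have h4 : IntegrableOn φ (Set.Icc (-1) 1) := hφ.integrableOn_Icc
  rw [← integrableOn_univ]
  refine ((h2.union h4).union h1).mono_set fun t _ => ?_
  rcases lt_or_ge t (-1) with ht | ht
  · exact .inl (.inl ht)
  · rcases le_or_gt t 1 with ht' | ht'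
    · exact .inl (.inr ⟨ht, ht'⟩)
    · exact .inr ht'

end IsLarge

/-! ### Second moments of the rescaled linear form -/

theorem step_pow_le_step_pow_add {a b c d : ℕ} (hS : a + b = c + d) {f g : ℕ × ℕ → ℝ} {C : ℝ}
    (n : ℕ) {u : ℕ × ℕ} (hu : 0 < u.1 + u.2)
    (hfg : ∀ v : ℕ × ℕ, v.1 + v.2 = u.1 + u.2 + n * (a + b) → f v ≤ g v + C) :
    (step a b c d ℝ ^ n) f u ≤ (step a b c d ℝ ^ n) g u + C := by
  induction n generalizing u with
  | zero => exact hfg u (by simp)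
  | succ n ih =>
    rw [step_pow_succ_apply, step_pow_succ_apply]
    have h1 : (step a b c d ℝ ^ n) f (u + (a, b)) ≤ (step a b c d ℝ ^ n) g (u + (a, b)) + C :=
      ih (by simp; omega) fun v hv => hfg v (by simp at hv; rw [hv]; ring)
    have h2 : (step a b c d ℝ ^ n) f (u + (c, d)) ≤ (step a b c d ℝ ^ n) g (u + (c, d)) + C :=
      ih (by simp; omega) fun v hv => hfg v (by
        simp at hv; rw [hv, add_mul, one_mul]; omega)
    have hpq := proportion_add_eq_one hu
    simp only [smul_eq_mul]
    calc _ ≤ (u.1 : ℝ) / ((u.1 : ℝ) + u.2) * ((step a b c d ℝ ^ n) g (u + (a, b)) + C) +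
        (u.2 : ℝ) / ((u.1 : ℝ) + u.2) * ((step a b c d ℝ ^ n) g (u + (c, d)) + C) := by gcongr
      _ = _ := by linear_combination C * hpq

namespace IsLarge

variable {a b c d : ℕ} (h : IsLarge a b c d)
include h

theorem step_u₂_mul (θ : ℝ) {u : ℕ × ℕ} (hu : 0 < u.1 + u.2) :
    step a b c d ℝ (fun v => θ * u₂ a b c v) u =
      θ * (1 + ((a : ℝ) - c) / ((u.1 : ℝ) + u.2)) * u₂ a b c u := by
  have hpq := proportion_add_eq_one hu
  have hmean := h.mean_increment hu
  rw [step_apply, h.u₂_add_red, h.u₂_add_black]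
  simp only [smul_eq_mul]
  linear_combination θ * hmean + θ * u₂ a b c u * hpq

/-- Decomposition into squared bias and variance; the variance `p q (X + Y)² θ²` is at most `S² θ²`.
-/
theorem step_sq_le (θ x : ℝ) {u : ℕ × ℕ} (hu : 0 < u.1 + u.2) :
    step a b c d ℝ (fun v => (θ * u₂ a b c v - x) ^ 2) u ≤
      (θ * (1 + ((a : ℝ) - c) / ((u.1 : ℝ) + u.2)) * u₂ a b c u - x) ^ 2 +
        ((a : ℝ) + b) ^ 2 * θ ^ 2 := by
  have hpq := proportion_add_eq_one hu
  have hmean := h.mean_increment hu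
  have hspread := h.spread_le
  rw [step_apply, h.u₂_add_red, h.u₂_add_black]
  simp only [smul_eq_mul]
  set p := (u.1 : ℝ) / ((u.1 : ℝ) + u.2)
  set q := (u.2 : ℝ) / ((u.1 : ℝ) + u.2)
  set X := b * ((a : ℝ) - c) / ((a : ℝ) + b)
  set Y := c * ((a : ℝ) - c) / ((a : ℝ) + b)
  set w := u₂ a b c u
  have hp0 : 0 ≤ p := by positivity
  have hq0 : 0 ≤ q := by positivity
  have hX0 : 0 ≤ X := div_nonneg (mul_nonneg h.b_pos.le h.drift_pos.le) h.balance_pos.le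
  have hY0 : 0 ≤ Y := div_nonneg (mul_nonneg h.c_pos.le h.drift_pos.le) h.balance_pos.le
  have e : θ * (1 + ((a : ℝ) - c) / ((u.1 : ℝ) + u.2)) * w = θ * (w + (p * X - q * Y)) := by
    rw [hmean]; ring
  rw [e]
  have hq : q = 1 - p := by linarith
  have key : p * (θ * (w + X) - x) ^ 2 + q * (θ * (w - Y) - x) ^ 2 =
      (θ * (w + (p * X - q * Y)) - x) ^ 2 + p * q * (X + Y) ^ 2 * θ ^ 2 := by
    rw [hq]; ring
  rw [key]
  have h1 : (X + Y) ^ 2 ≤ ((a : ℝ) + b) ^ 2 := pow_le_pow_left₀ (by positivity) hspread 2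
  have h2 : p * q ≤ 1 := mul_le_one₀ (by linarith) hq0 (by linarith)
  have h3 : p * q * (X + Y) ^ 2 ≤ 1 * ((a : ℝ) + b) ^ 2 :=
    mul_le_mul h2 h1 (by positivity) zero_le_one
  have h4 := mul_le_mul_of_nonneg_right h3 (sq_nonneg θ)
  linarith

theorem step_pow_sq_le {s : ℕ} (hs : 0 < s) (x : ℝ) (n k : ℕ) {u : ℕ × ℕ}
    (hu : u.1 + u.2 = s + n * (a + b)) :
    (step a b c d ℝ ^ k) (fun v => (1 / growth a b c s (n + k) * u₂ a b c v - x) ^ 2) u ≤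
      (1 / growth a b c s n * u₂ a b c u - x) ^ 2 +
        ((a : ℝ) + b) ^ 2 * ∑ j ∈ Finset.range k, 1 / growth a b c s (n + j + 1) ^ 2 := by
  induction k with
  | zero => simp
  | succ k ih =>
    rw [step_pow_succ_apply', Finset.sum_range_succ, mul_add]
    refine le_trans ?_ ((add_le_add_left ih _).trans_eq (add_assoc _ _ _))
    refine step_pow_le_step_pow_add h.balanced k (by omega) fun v hv => ?_
    refine (h.step_sq_le _ x (by omega)).trans (le_of_eq ?_)
    have h1 : 1 / growth a b c s (n + (k + 1)) * (1 + ((a : ℝ) - c) / ((v.1 : ℝ) + v.2)) =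
        1 / growth a b c s (n + k) := by
      have h2 := (zero_lt_one.trans_le (h.one_le_factor s (n + k))).ne'
      have h3 : (v.1 : ℝ) + v.2 = s + (n + k : ℕ) * ((a : ℝ) + b) := by
        rw [hu] at hv
        have : v.1 + v.2 = s + (n + k) * (a + b) := by rw [hv]; ring
        exact_mod_cast this
      rw [← add_assoc, growth_succ, h3, one_div_mul_eq_div, div_mul_cancel_right₀ h2, one_div]
    rw [h1, one_div_pow, add_assoc n k 1]

end IsLarge

/-! ### The process: Markov property, martingale, law of the limit -/

namespace IsProcess

variable {Ω : Type*} [mΩ : MeasurableSpace Ω] {μ : Measure Ω} {a b c d α β : ℕ}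
  {U : ℕ → Ω → ℕ × ℕ}

/-- The trajectory of the process up to time `n`. -/
def past (U : ℕ → Ω → ℕ × ℕ) (n : ℕ) (ω : Ω) (k : Fin (n + 1)) : ℕ × ℕ := U k ω

theorem measurable_past (hU : IsProcess μ a b c d α β U) (n : ℕ) : Measurable (past U n) :=
  measurable_pi_lambda _ fun k => hU.measurable k

/-- The filtration generated by the process. -/
def filtration (hU : IsProcess μ a b c d α β U) : Filtration ℕ mΩ where
  seq n := MeasurableSpace.comap (past U n) ⊤
  mono' n m hnm := by
    have : past U n = (fun p (k : Fin (n + 1)) => p (Fin.castLE (by omega) k)) ∘ past U m := rfl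
    change MeasurableSpace.comap (past U n) ⊤ ≤ MeasurableSpace.comap (past U m) ⊤
    rw [this, ← MeasurableSpace.comap_comp]
    exact MeasurableSpace.comap_mono le_top
  le' n := by
    rintro A ⟨B, -, rfl⟩
    exact hU.measurable_past n (.of_discrete)

theorem measureReal_past_inter (hU : IsProcess μ a b c d α β U) (n : ℕ)
    (p : Fin (n + 1) → ℕ × ℕ) (v : ℕ × ℕ) :
    μ.real (past U n ⁻¹' {p} ∩ U (n + 1) ⁻¹' {v}) =
      μ.real (past U n ⁻¹' {p}) * transition a b c d (p (Fin.last n)) v := by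
  -- The values after time `n` are irrelevant and set to `0`.
  let g : ℕ → ℕ × ℕ := fun k => if hk : k ≤ n then p ⟨k, Nat.lt_succ_iff.2 hk⟩ else 0
  have hset : past U n ⁻¹' {p} = {ω | ∀ k ≤ n, U k ω = g k} := by
    ext ω
    simp only [Set.mem_preimage, Set.mem_singleton_iff, Set.mem_ofPred_eq, funext_iff, past]
    constructor
    · intro hω k hk
      simpa [g, hk] using hω ⟨k, Nat.lt_succ_iff.2 hk⟩
    · intro hω k
      have := hω k (Nat.lt_succ_iff.1 k.2)
      simpa [g, Nat.lt_succ_iff.1 k.2] using this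
  have hlast : g n = p (Fin.last n) := by simp [g, Fin.last]
  have := hU.markov n g v
  rw [hlast] at this
  rw [hset, ← this]
  rfl

/-- Other successors have transition probability zero, and there are only countably many pairs of a
past and a successor. -/
theorem ae_succ [IsFiniteMeasure μ] (hU : IsProcess μ a b c d α β U) (n : ℕ) :
    ∀ᵐ ω ∂μ, U (n + 1) ω = U n ω + (a, b) ∨ U (n + 1) ω = U n ω + (c, d) := by
  have key : ∀ᵐ ω ∂μ, ∀ (p : Fin (n + 1) → ℕ × ℕ) (v : ℕ × ℕ), v ≠ p (Fin.last n) + (a, b) →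
      v ≠ p (Fin.last n) + (c, d) → ¬ (past U n ω = p ∧ U (n + 1) ω = v) := by
    simp only [ae_all_iff]
    intro p v h1 h2
    have := hU.measureReal_past_inter n p v
    rw [transition, if_neg h1, if_neg h2, mul_zero, mul_zero, add_zero, mul_zero,
      measureReal_eq_zero_iff] at this
    rw [ae_iff]
    simp only [not_not]
    exact this
  filter_upwards [key] with ω hω
  by_contra! hne
  exact hω (past U n ω) (U (n + 1) ω) hne.1 hne.2 ⟨rfl, rfl⟩

theorem ae_total [IsFiniteMeasure μ] (hU : IsProcess μ a b c d α β U) (hS : a + b = c + d)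
    (n : ℕ) : ∀ᵐ ω ∂μ, (U n ω).1 + (U n ω).2 = α + β + n * (a + b) := by
  induction n with
  | zero => filter_upwards [hU.init] with ω hω; simp [hω]
  | succ n ih =>
    filter_upwards [ih, hU.ae_succ n] with ω h1 h2
    rcases h2 with h2 | h2 <;> rw [h2] <;> simp only [Prod.fst_add, Prod.snd_add] <;>
      rw [add_mul, one_mul] <;> omega

/-- The total at time `n` is almost surely deterministic, so only finitely many compositions occur.
-/
theorem integrable_comp [IsFiniteMeasure μ] (hU : IsProcess μ a b c d α β U)
    (hS : a + b = c + d) {E : Type*} [NormedAddCommGroup E] [SecondCountableTopology E]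
    [MeasurableSpace E] [BorelSpace E] (f : ℕ × ℕ → E) (n : ℕ) :
    Integrable (fun ω => f (U n ω)) μ := by
  refine (integrable_const (∑ v ∈ Finset.HasAntidiagonal.antidiagonal (α + β + n * (a + b)),
    ‖f v‖)).mono' ?_ ?_
  · exact ((Measurable.of_discrete (f := f)).comp (hU.measurable n)).aestronglyMeasurable
  · filter_upwards [hU.ae_total hS n] with ω hω
    exact Finset.single_le_sum (f := fun v => ‖f v‖) (fun _ _ => norm_nonneg _)
      (Finset.HasAntidiagonal.mem_antidiagonal.2 hω)

theorem setIntegral_past [IsFiniteMeasure μ] (hU : IsProcess μ a b c d α β U)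
    (hR : (a, b) ≠ (c, d)) {E : Type*} [NormedAddCommGroup E] [NormedSpace ℝ E] [CompleteSpace E]
    (f : ℕ × ℕ → E) (n : ℕ) (p : Fin (n + 1) → ℕ × ℕ) :
    ∫ ω in past U n ⁻¹' {p}, f (U (n + 1) ω) ∂μ =
      ∫ ω in past U n ⁻¹' {p}, step a b c d E f (U n ω) ∂μ := by
  have hmp : MeasurableSet (past U n ⁻¹' {p}) := hU.measurable_past n (measurableSet_singleton p)
  set v := p (Fin.last n) with hv
  have hlast : ∀ ω ∈ past U n ⁻¹' {p}, U n ω = v := fun ω hω => by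
    have := congrFun (show past U n ω = p from hω) (Fin.last n)
    exact this
  have hm : ∀ w, MeasurableSet (U (n + 1) ⁻¹' {w}) := fun w =>
    hU.measurable (n + 1) (measurableSet_singleton w)
  -- Distinct rows make the two successor events disjoint; otherwise the sum of indicators would
  -- count one event twice.
  have hne : v + (a, b) ≠ v + (c, d) := fun he => hR (add_left_cancel he)
  have e1 : ∫ ω in past U n ⁻¹' {p}, f (U (n + 1) ω) ∂μ = ∫ ω in past U n ⁻¹' {p},
      ((U (n + 1) ⁻¹' {v + (a, b)}).indicator (fun _ => f (v + (a, b))) ω +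
      (U (n + 1) ⁻¹' {v + (c, d)}).indicator (fun _ => f (v + (c, d))) ω) ∂μ := by
    refine integral_congr_ae ?_
    rw [EventuallyEq, ae_restrict_iff' hmp]
    filter_upwards [hU.ae_succ n] with ω hω hp
    rw [hlast ω hp] at hω
    rcases hω with hω | hω
    · rw [Set.indicator_of_mem (by exact hω), Set.indicator_of_notMem, add_zero, hω]
      intro h'
      exact hne (hω.symm.trans h')
    · rw [Set.indicator_of_notMem, Set.indicator_of_mem (by exact hω), zero_add, hω]
      intro h'
      exact hne (h'.symm.trans hω)
  have e2 : ∫ ω in past U n ⁻¹' {p}, step a b c d E f (U n ω) ∂μ =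
      ∫ ω in past U n ⁻¹' {p}, step a b c d E f v ∂μ :=
    setIntegral_congr_fun hmp fun ω hω => by simp only [hlast ω hω]
  rw [e1, e2, integral_add ((integrable_const _).indicator (hm _))
    ((integrable_const _).indicator (hm _)), integral_indicator (hm _), integral_indicator (hm _),
    Measure.restrict_restrict (hm _), Measure.restrict_restrict (hm _), setIntegral_const,
    setIntegral_const, setIntegral_const, Set.inter_comm, hU.measureReal_past_inter, Set.inter_comm,
    hU.measureReal_past_inter, ← hv, step_apply, transition, transition, if_pos rfl, if_neg hne,
    if_neg hne.symm, if_pos rfl, smul_add, smul_smul, smul_smul]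
  simp

/-- An event of the past is a countable disjoint union of events fixing the trajectory. -/
theorem setIntegral_succ [IsFiniteMeasure μ] (hU : IsProcess μ a b c d α β U)
    (hS : a + b = c + d) (hR : (a, b) ≠ (c, d)) {E : Type*} [NormedAddCommGroup E]
    [NormedSpace ℝ E] [CompleteSpace E] [SecondCountableTopology E] [MeasurableSpace E]
    [BorelSpace E] (f : ℕ × ℕ → E) (n : ℕ) {A : Set Ω} (hA : MeasurableSet[hU.filtration n] A) :
    ∫ ω in A, f (U (n + 1) ω) ∂μ = ∫ ω in A, step a b c d E f (U n ω) ∂μ := by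
  obtain ⟨B, -, rfl⟩ := hA
  have hB : past U n ⁻¹' B = ⋃ p : B, past U n ⁻¹' {(p : Fin (n + 1) → ℕ × ℕ)} := by
    ext ω; simp
  have hm : ∀ p : B, MeasurableSet (past U n ⁻¹' {(p : Fin (n + 1) → ℕ × ℕ)}) := fun p =>
    hU.measurable_past n (measurableSet_singleton _)
  have hd : Pairwise (Function.onFun Disjoint
      fun p : B => past U n ⁻¹' {(p : Fin (n + 1) → ℕ × ℕ)}) := by
    intro p q hpq
    refine Disjoint.preimage _ (Set.disjoint_singleton.2 fun he => hpq (Subtype.ext he))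
  rw [hB, integral_iUnion hm hd (hU.integrable_comp hS f (n + 1)).integrableOn,
    integral_iUnion hm hd (hU.integrable_comp hS (step a b c d E f) n).integrableOn]
  exact tsum_congr fun p => hU.setIntegral_past hR f n p

theorem setIntegral_add [IsFiniteMeasure μ] (hU : IsProcess μ a b c d α β U)
    (hS : a + b = c + d) (hR : (a, b) ≠ (c, d)) {E : Type*} [NormedAddCommGroup E]
    [NormedSpace ℝ E] [CompleteSpace E] [SecondCountableTopology E] [MeasurableSpace E]
    [BorelSpace E] (f : ℕ × ℕ → E) (n k : ℕ) {A : Set Ω} (hA : MeasurableSet[hU.filtration n] A) :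
    ∫ ω in A, f (U (n + k) ω) ∂μ = ∫ ω in A, (step a b c d E ^ k) f (U n ω) ∂μ := by
  induction k generalizing f with
  | zero => rfl
  | succ k ih =>
    rw [← add_assoc, hU.setIntegral_succ hS hR f (n + k)
      (hU.filtration.mono (Nat.le_add_right n k) _ hA), ih]
    simp only [step_pow_succ_apply']

theorem integral_comp [IsProbabilityMeasure μ] (hU : IsProcess μ a b c d α β U)
    (hS : a + b = c + d) (hR : (a, b) ≠ (c, d)) {E : Type*} [NormedAddCommGroup E]
    [NormedSpace ℝ E] [CompleteSpace E] [SecondCountableTopology E] [MeasurableSpace E]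
    [BorelSpace E] (f : ℕ × ℕ → E) (n : ℕ) :
    ∫ ω, f (U n ω) ∂μ = (step a b c d E ^ n) f (α, β) := by
  have := hU.setIntegral_add hS hR f 0 n (A := Set.univ) MeasurableSet.univ
  rw [zero_add, setIntegral_univ, setIntegral_univ] at this
  rw [this]
  have h0 : (fun ω => (step a b c d E ^ n) f (U 0 ω)) =ᵐ[μ]
      fun _ => (step a b c d E ^ n) f (α, β) := by
    filter_upwards [hU.init] with ω hω
    rw [hω]
  rw [integral_congr_ae h0]
  simp

variable (h : IsLarge a b c d)
include h

theorem _root_.PolyaUrn.IsLarge.rows_ne : (a, b) ≠ (c, d) := by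
  intro he
  have h1 := h.drift_pos
  have h2 : a = c := congrArg Prod.fst he
  rw [h2, sub_self] at h1
  exact h1.false

theorem martingale [IsProbabilityMeasure μ] (hU : IsProcess μ a b c d α β U) (hs : 0 < α + β) :
    Martingale (fun n ω => 1 / growth a b c (α + β) n * u₂ a b c (U n ω)) hU.filtration μ := by
  have hint := fun n => hU.integrable_comp h.balanced
    (fun v => 1 / growth a b c (α + β) n * u₂ a b c v) n
  have hmeas : ∀ (n : ℕ) (f : ℕ × ℕ → ℝ),
      StronglyMeasurable[hU.filtration n] fun ω => f (U n ω) := by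
    intro n f
    refine Measurable.stronglyMeasurable fun s _ => ?_
    exact ⟨(fun p : Fin (n + 1) → ℕ × ℕ => f (p (Fin.last n))) ⁻¹' s, trivial, rfl⟩
  refine martingale_nat
    (fun n => hmeas n fun v => 1 / growth a b c (α + β) n * u₂ a b c v) hint fun n => ?_
  refine ae_eq_condExp_of_forall_setIntegral_eq (hU.filtration.le n) (hint (n + 1))
    (fun _ _ _ => (hint n).integrableOn) (fun A hA _ => ?_)
    (hmeas n fun v => 1 / growth a b c (α + β) n * u₂ a b c v).aestronglyMeasurable
  rw [hU.setIntegral_succ h.balanced h.rows_ne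
    (fun v => 1 / growth a b c (α + β) (n + 1) * u₂ a b c v) n hA]
  refine integral_congr_ae (ae_restrict_of_ae ?_)
  filter_upwards [hU.ae_total h.balanced n] with ω hω
  rw [h.step_u₂_mul _ (by omega)]
  have h2 := (zero_lt_one.trans_le (h.one_le_factor (α + β) n)).ne'
  have h3 : ((U n ω).1 : ℝ) + (U n ω).2 = (α + β : ℕ) + n * ((a : ℝ) + b) := by exact_mod_cast hω
  have h4 : 1 / growth a b c (α + β) (n + 1) *
      (1 + ((a : ℝ) - c) / ((α + β : ℕ) + n * ((a : ℝ) + b))) = 1 / growth a b c (α + β) n := by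
    rw [growth_succ, one_div_mul_eq_div, div_mul_cancel_right₀ h2, one_div]
  rw [h3, h4]

/-- The second moments are bounded by the summable series, and `|x| ≤ 1 + x²`. -/
theorem exists_eLpNorm_le [IsProbabilityMeasure μ] (hU : IsProcess μ a b c d α β U)
    (hs : 0 < α + β) : ∃ R : NNReal, ∀ n,
      eLpNorm (fun ω => 1 / growth a b c (α + β) n * u₂ a b c (U n ω)) 1 μ ≤ R := by
  set C := (1 / growth a b c (α + β) 0 * u₂ a b c (α, β) - 0) ^ 2 +
    ((a : ℝ) + b) ^ 2 * growthTail a b c (α + β) 0 with hC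
  refine ⟨Real.toNNReal (1 + C), fun n => ?_⟩
  have h1 := h.step_pow_sq_le hs 0 0 n (u := (α, β)) (by simp)
  have h2 : (step a b c d ℝ ^ n)
      (fun v => (1 / growth a b c (α + β) (0 + n) * u₂ a b c v - 0) ^ 2) (α, β) ≤ C := by
    refine h1.trans ?_
    rw [hC]
    gcongr
    exact h.sum_le_growthTail hs 0 n
  rw [← hU.integral_comp h.balanced h.rows_ne, zero_add] at h2
  simp only [sub_zero] at h2
  have hint := hU.integrable_comp h.balanced
    (fun v => 1 / growth a b c (α + β) n * u₂ a b c v) n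
  have hint2 := hU.integrable_comp h.balanced
    (fun v => (1 / growth a b c (α + β) n * u₂ a b c v) ^ 2) n
  rw [eLpNorm_one_eq_lintegral_enorm, ← ofReal_integral_norm_eq_lintegral_enorm hint]
  refine ENNReal.ofReal_le_ofReal ?_
  calc _ ≤ ∫ ω, 1 + (1 / growth a b c (α + β) n * u₂ a b c (U n ω)) ^ 2 ∂μ := by
        refine integral_mono hint.norm ((integrable_const _).add hint2) fun ω => ?_
        simp only [Real.norm_eq_abs]
        rw [← sq_abs (1 / growth a b c (α + β) n * u₂ a b c (U n ω))]
        nlinarith [sq_nonneg (|1 / growth a b c (α + β) n * u₂ a b c (U n ω)| - 1)]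
    _ ≤ 1 + C := by
        rw [integral_add (integrable_const _) hint2]
        simpa using h2

/-- The urn process admits a limit variable. -/
theorem exists_tendsto [IsProbabilityMeasure μ] (hU : IsProcess μ a b c d α β U)
    (hs : 0 < α + β) : ∃ M : Ω → ℝ, Measurable M ∧
      ∀ᵐ ω ∂μ, Tendsto (fun n => 1 / growth a b c (α + β) n * u₂ a b c (U n ω)) atTop
        (𝓝 (M ω)) := by
  obtain ⟨R, hR⟩ := hU.exists_eLpNorm_le h hs
  exact measurable_limit_of_tendsto_metrizable_ae
    (fun n => (hU.integrable_comp h.balanced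
      (fun v => 1 / growth a b c (α + β) n * u₂ a b c v) n).aemeasurable)
    ((hU.martingale h hs).submartingale.exists_ae_tendsto_of_bdd hR)

theorem _root_.PolyaUrn.IsLarge.isLimit_of_tendsto (hs : 0 < α + β) {M : Ω → ℝ} (hM : Measurable M)
    (hlim : ∀ᵐ ω ∂μ, Tendsto (fun n => 1 / growth a b c (α + β) n * u₂ a b c (U n ω)) atTop
      (𝓝 (M ω))) :
    IsLimit μ a b c U fun ω => growthConst a b c (α + β) * M ω := by
  refine ⟨hM.const_mul _, ?_⟩
  filter_upwards [hlim] with ω hω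
  refine ((h.tendsto_growth_div hs).mul hω).congr fun n => ?_
  have := (h.growth_pos (α + β) n).ne'
  field_simp

theorem charFun_map_eq [IsProbabilityMeasure μ] (hU : IsProcess μ a b c d α β U)
    (hs : 0 < α + β) {W : Ω → ℝ} (hW : IsLimit μ a b c U W) (t : ℝ) :
    charFun (μ.map W) t = limitChar a b c d (α, β) t := by
  rw [charFun_apply_real, integral_map hW.1.aemeasurable (by fun_prop)]
  refine tendsto_nhds_unique ?_ (h.tendsto_charSeq_div_rpow (u := (α, β)) hs t)
  have e : ∀ n : ℕ, charSeq a b c d n (t / (n : ℝ) ^ ratio a b c) (α, β) =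
      ∫ ω, wave a b c (t / (n : ℝ) ^ ratio a b c) (U n ω) ∂μ := fun n =>
    (hU.integral_comp h.balanced h.rows_ne _ n).symm
  simp only [e]
  refine tendsto_integral_of_dominated_convergence (fun _ => 1) (fun n => ?_) (integrable_const _)
    (fun n => .of_forall fun ω => (norm_wave ..).le) ?_
  · exact (hU.integrable_comp h.balanced _ n).aestronglyMeasurable
  · filter_upwards [hW.2] with ω hω
    have h1 := hω.const_mul t
    have h2 : Continuous fun x : ℝ => Complex.exp (x * Complex.I) := by fun_prop
    have h3 := (h2.tendsto _).comp h1
    rw [Complex.ofReal_mul] at h3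
    refine h3.congr fun n => ?_
    simp only [Function.comp, wave]
    congr 3
    ring

theorem integrable_charFun_map [IsProbabilityMeasure μ] (hU : IsProcess μ a b c d α β U)
    (hs : 0 < α + β) {W : Ω → ℝ} (hW : IsLimit μ a b c U W) :
    Integrable (charFun (μ.map W)) := by
  have heq := hU.charFun_map_eq h hs hW
  refine h.integrable_of_norm_eq_limitChar (u := (α, β)) hs ?_ (fun t => ?_) heq
  · rw [funext heq]
    exact h.continuous_limitChar (u := (α, β)) hs
  · rw [charFun_neg, RCLike.norm_conj]

end IsProcess

/-! ### Reachable compositions -/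

theorem step_pow_nonneg (a b c d : ℕ) {f : ℕ × ℕ → ℝ} (hf : ∀ v, 0 ≤ f v) (n : ℕ) (u : ℕ × ℕ) :
    0 ≤ (step a b c d ℝ ^ n) f u := by
  induction n generalizing u with
  | zero => exact hf u
  | succ n ih =>
    rw [step_pow_succ_apply]
    have h1 := ih (u + (a, b))
    have h2 := ih (u + (c, d))
    simp only [smul_eq_mul]
    positivity

theorem step_pow_succ_pos_of_red {a b c d : ℕ} {f : ℕ × ℕ → ℝ} (hf : ∀ v, 0 ≤ f v) {n : ℕ}
    {u : ℕ × ℕ} (hu : 0 < u.1) (hpos : 0 < (step a b c d ℝ ^ n) f (u + (a, b))) :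
    0 < (step a b c d ℝ ^ (n + 1)) f u := by
  rw [step_pow_succ_apply]
  have h2 := step_pow_nonneg a b c d hf n (u + (c, d))
  have h3 : (0 : ℝ) < u.1 := by exact_mod_cast hu
  simp only [smul_eq_mul]
  positivity

theorem step_pow_succ_pos_of_black {a b c d : ℕ} {f : ℕ × ℕ → ℝ} (hf : ∀ v, 0 ≤ f v) {n : ℕ}
    {u : ℕ × ℕ} (hu : 0 < u.2) (hpos : 0 < (step a b c d ℝ ^ n) f (u + (c, d))) :
    0 < (step a b c d ℝ ^ (n + 1)) f u := by
  rw [step_pow_succ_apply]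
  have h2 := step_pow_nonneg a b c d hf n (u + (a, b))
  have h3 : (0 : ℝ) < u.2 := by exact_mod_cast hu
  simp only [smul_eq_mul]
  positivity

/-- All red drawings are made before the black ones; both colors remain present, so each drawing has
positive probability. -/
theorem step_pow_add_pos {a b c d : ℕ} {f : ℕ × ℕ → ℝ} (hf : ∀ v, 0 ≤ f v) (i j : ℕ)
    {u : ℕ × ℕ} (h1 : 0 < u.1) (h2 : 0 < u.2) (hpos : 0 < f (u + i • (a, b) + j • (c, d))) :
    0 < (step a b c d ℝ ^ (i + j)) f u := by
  induction i generalizing u with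
  | zero =>
    rw [zero_add]
    rw [zero_smul, add_zero] at hpos
    induction j generalizing u with
    | zero => simpa using hpos
    | succ j ih =>
      refine step_pow_succ_pos_of_black hf h2 (ih (by simp; omega) (by simp; omega) ?_)
      rwa [add_assoc, ← succ_nsmul']
  | succ i ih =>
    rw [add_right_comm]
    refine step_pow_succ_pos_of_red hf h1 (ih (by simp; omega) (by simp; omega) ?_)
    rwa [add_assoc u, ← succ_nsmul']

namespace IsLarge

variable {a b c d : ℕ} (h : IsLarge a b c d)
include h

theorem u₂_add_nsmul (u : ℕ × ℕ) (i j : ℕ) : u₂ a b c (u + i • (a, b) + j • (c, d)) =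
    u₂ a b c u + i * (b * ((a : ℝ) - c) / ((a : ℝ) + b)) -
      j * (c * ((a : ℝ) - c) / ((a : ℝ) + b)) := by
  induction j with
  | zero =>
    induction i with
    | zero => simp
    | succ i ih =>
      simp only [zero_smul, add_zero, Nat.cast_zero, zero_mul, sub_zero] at ih ⊢
      rw [succ_nsmul, ← add_assoc, h.u₂_add_red, ih]
      push_cast
      ring
  | succ j ih =>
    rw [succ_nsmul, ← add_assoc, h.u₂_add_black, ih]
    push_cast
    ring

/-- From any nonempty urn, one drawing reaches an urn with both colors. -/
theorem exists_step_pow_succ_pos {u : ℕ × ℕ} (hu : 0 < u.1 + u.2) :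
    ∃ v : ℕ × ℕ, v.1 + v.2 = u.1 + u.2 + (a + b) ∧ ∀ (f : ℕ × ℕ → ℝ), (∀ w, 0 ≤ f w) →
      ∀ i j : ℕ, 0 < f (v + i • (a, b) + j • (c, d)) →
      0 < (step a b c d ℝ ^ (i + j + 1)) f u := by
  have ha := h.a_pos
  have hd := h.d_pos
  have hb := Nat.pos_of_ne_zero h.b_ne_zero
  have hc := Nat.pos_of_ne_zero h.c_ne_zero
  have hS := h.balanced
  rcases Nat.eq_zero_or_pos u.1 with h1 | h1
  · refine ⟨u + (c, d), by simp; omega, fun f hf i j hpos => ?_⟩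
    exact step_pow_succ_pos_of_black hf (by omega)
      (step_pow_add_pos hf i j (by simp; omega) (by simp; omega) hpos)
  · refine ⟨u + (a, b), by simp; omega, fun f hf i j hpos => ?_⟩
    exact step_pow_succ_pos_of_red hf h1
      (step_pow_add_pos hf i j (by simp; omega) (by simp; omega) hpos)

theorem tendsto_growth_atTop {s : ℕ} (hs : 0 < s) : Tendsto (growth a b c s) atTop atTop := by
  have h1 : Tendsto (fun n : ℕ => (n : ℝ) ^ ratio a b c) atTop atTop :=
    (tendsto_rpow_atTop h.ratio_pos).comp tendsto_natCast_atTop_atTop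
  refine ((h.tendsto_growth_div hs).pos_mul_atTop (h.growthConst_pos hs) h1).congr' ?_
  filter_upwards [eventually_gt_atTop 0] with n hn
  have hn' : (0 : ℝ) < n := by exact_mod_cast hn
  exact div_mul_cancel₀ _ (Real.rpow_pos_of_pos hn' _).ne'

/-- Since `σ < 1`, the range of `u₂` over reachable compositions, linear in `n`, outgrows the
normalization. -/
theorem tendsto_growth_div_self {s : ℕ} (hs : 0 < s) :
    Tendsto (fun n : ℕ => growth a b c s (n + 1) / n) atTop (𝓝 0) := by
  have h1 : Tendsto (fun n : ℕ => (n : ℝ) ^ (-(1 - ratio a b c))) atTop (𝓝 0) :=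
    (tendsto_rpow_neg_atTop (by linarith [h.ratio_lt_one])).comp tendsto_natCast_atTop_atTop
  have h2 := (h.tendsto_growth_div hs).mul h1
  rw [mul_zero] at h2
  have h3 : Tendsto (fun n : ℕ => growth a b c s n / n) atTop (𝓝 0) := by
    refine h2.congr' ?_
    filter_upwards [eventually_gt_atTop 0] with n hn
    have hn' : (0 : ℝ) < n := by exact_mod_cast hn
    have := Real.rpow_pos_of_pos hn' (ratio a b c)
    rw [neg_sub, Real.rpow_sub hn', Real.rpow_one]
    field_simp
  have h4 : Tendsto (fun n : ℕ => (1 + 1 / (n : ℝ))) atTop (𝓝 (1 + 0)) :=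
    tendsto_const_nhds.add (tendsto_one_div_atTop_nhds_zero_nat (𝕜 := ℝ))
  have h5 := (h3.comp (tendsto_add_atTop_nat 1)).mul h4
  rw [zero_mul] at h5
  refine h5.congr' ?_
  filter_upwards [eventually_gt_atTop 0] with n hn
  have hn' : (0 : ℝ) < n := by exact_mod_cast hn
  simp only [Function.comp]
  push_cast
  field_simp

/-- The rescaled values of `u₂` at the reachable compositions come close to any real number. -/
theorem exists_composition_near {s : ℕ} (hs : 0 < s) (u : ℕ × ℕ) (y : ℝ) {δ : ℝ} (hδ : 0 < δ) :
    ∀ᶠ n : ℕ in atTop, ∃ i j : ℕ, i + j = n ∧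
      |1 / growth a b c s (n + 1) * u₂ a b c (u + i • (a, b) + j • (c, d)) - y| < δ := by
  set X := b * ((a : ℝ) - c) / ((a : ℝ) + b) with hX
  set Y := c * ((a : ℝ) - c) / ((a : ℝ) + b) with hY
  have hX0 : 0 < X := div_pos (mul_pos h.b_pos h.drift_pos) h.balance_pos
  have hY0 : 0 < Y := div_pos (mul_pos h.c_pos h.drift_pos) h.balance_pos
  have h1 : Tendsto (fun n : ℕ => growth a b c s (n + 1) / n * y - u₂ a b c u * (1 / (n : ℝ)))
      atTop (𝓝 (0 * y - u₂ a b c u * 0)) :=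
    ((h.tendsto_growth_div_self hs).mul_const y).sub
      ((tendsto_one_div_atTop_nhds_zero_nat (𝕜 := ℝ)).const_mul _)
  rw [zero_mul, mul_zero, sub_zero] at h1
  have h2 : Tendsto (fun n : ℕ => (X + Y) / growth a b c s (n + 1)) atTop (𝓝 0) :=
    tendsto_const_nhds.div_atTop ((h.tendsto_growth_atTop hs).comp (tendsto_add_atTop_nat 1))
  filter_upwards [h1.eventually (lt_mem_nhds (neg_lt_zero.2 hY0)),
    h1.eventually (gt_mem_nhds hX0), h2.eventually (gt_mem_nhds hδ), eventually_gt_atTop 0]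
    with n hlow hupp hsmall hn
  have hn' : (0 : ℝ) < n := by exact_mod_cast hn
  have hγ := h.growth_pos s (n + 1)
  set γ := growth a b c s (n + 1)
  have e : γ / n * y - u₂ a b c u * (1 / (n : ℝ)) = (γ * y - u₂ a b c u) / n := by ring
  rw [e, lt_div_iff₀ hn'] at hlow
  rw [e, div_lt_iff₀ hn'] at hupp
  -- The real number of red drawings among `n` that would give exactly `γ y`. It lies in `[0, n)`
  -- for large `n`, and rounding down costs at most `(X + Y) / γ` after rescaling.
  set r := (γ * y - u₂ a b c u + n * Y) / (X + Y) with hr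
  have hr0 : 0 ≤ r := div_nonneg (by linarith) (by linarith)
  have hrn : r < n := by rw [hr, div_lt_iff₀ (by linarith)]; linarith
  have hfl := Nat.floor_le hr0
  have hfl' := Nat.lt_floor_add_one r
  have hin : ⌊r⌋₊ ≤ n := by exact_mod_cast hfl.trans hrn.le
  refine ⟨⌊r⌋₊, n - ⌊r⌋₊, by omega, ?_⟩
  rw [h.u₂_add_nsmul, Nat.cast_sub hin, ← hX, ← hY]
  have hrXY : r * (X + Y) = γ * y - u₂ a b c u + n * Y := div_mul_cancel₀ _ (by linarith)
  have e2 : 1 / γ * (u₂ a b c u + ⌊r⌋₊ * X - ((n : ℝ) - ⌊r⌋₊) * Y) - y =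
      -((r - ⌊r⌋₊) * (X + Y) / γ) := by
    field_simp
    linarith
  rw [e2, abs_neg, abs_of_nonneg (div_nonneg (mul_nonneg (by linarith) (by linarith)) hγ.le)]
  refine lt_of_le_of_lt ?_ hsmall
  gcongr
  exact mul_le_of_le_one_left (by linarith) (by linarith)

end IsLarge

/-! ### The support of the limit law -/

namespace IsProcess

variable {Ω : Type*} [mΩ : MeasurableSpace Ω] {μ : Measure Ω} {a b c d α β : ℕ}
  {U : ℕ → Ω → ℕ × ℕ}

theorem measurableSet_filtration (hU : IsProcess μ a b c d α β U) (n : ℕ) (v : ℕ × ℕ) :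
    MeasurableSet[hU.filtration n] (U n ⁻¹' {v}) :=
  ⟨{p | p (Fin.last n) = v}, trivial, rfl⟩

theorem measureReal_preimage [IsProbabilityMeasure μ] (hU : IsProcess μ a b c d α β U)
    (hS : a + b = c + d) (hR : (a, b) ≠ (c, d)) (n : ℕ) (v : ℕ × ℕ) :
    μ.real (U n ⁻¹' {v}) = (step a b c d ℝ ^ n) (Set.indicator {v} 1) (α, β) := by
  rw [← hU.integral_comp hS hR,
    ← integral_indicator_one (hU.measurable n (measurableSet_singleton v))]
  rfl

variable (h : IsLarge a b c d)
include h

/-- Centered at the value taken at time `n`, the second moment has no bias, only the accumulated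
variance. -/
theorem setIntegral_sq_le [IsProbabilityMeasure μ] (hU : IsProcess μ a b c d α β U)
    (hs : 0 < α + β) (n k : ℕ) {v : ℕ × ℕ} (hv : v.1 + v.2 = α + β + n * (a + b)) :
    ∫ ω in U n ⁻¹' {v}, (1 / growth a b c (α + β) (n + k) * u₂ a b c (U (n + k) ω) -
      1 / growth a b c (α + β) n * u₂ a b c v) ^ 2 ∂μ ≤
      μ.real (U n ⁻¹' {v}) * (((a : ℝ) + b) ^ 2 * growthTail a b c (α + β) n) := by
  set m := 1 / growth a b c (α + β) n * u₂ a b c v with hm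
  rw [hU.setIntegral_add h.balanced h.rows_ne
    (fun w => (1 / growth a b c (α + β) (n + k) * u₂ a b c w - m) ^ 2) n k
    (hU.measurableSet_filtration n v),
    setIntegral_congr_fun (g := fun _ => (step a b c d ℝ ^ k)
      (fun w => (1 / growth a b c (α + β) (n + k) * u₂ a b c w - m) ^ 2) v)
      (hU.measurable n (measurableSet_singleton v))
      (fun ω hω => by rw [show U n ω = v from hω]), setIntegral_const, smul_eq_mul]
  refine mul_le_mul_of_nonneg_left ((h.step_pow_sq_le hs m n k hv).trans ?_) measureReal_nonneg
  rw [← hm, sub_self, zero_pow two_ne_zero, zero_add]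
  exact mul_le_mul_of_nonneg_left (h.sum_le_growthTail hs n k) (by positivity)

theorem not_ae_le_abs_sub [IsProbabilityMeasure μ] (hU : IsProcess μ a b c d α β U)
    (hs : 0 < α + β) {M : Ω → ℝ}
    (hlim : ∀ᵐ ω ∂μ, Tendsto (fun n => 1 / growth a b c (α + β) n * u₂ a b c (U n ω)) atTop
      (𝓝 (M ω))) (y : ℝ) {δ : ℝ} (hδ : 0 < δ) : ¬ ∀ᵐ ω ∂μ, δ ≤ |M ω - y| := by
  intro hfar
  obtain ⟨u, hu, hreach⟩ := h.exists_step_pow_succ_pos (u := (α, β)) hs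
  have htail : Tendsto (fun n => ((a : ℝ) + b) ^ 2 * growthTail a b c (α + β) (n + 1)) atTop
      (𝓝 (((a : ℝ) + b) ^ 2 * 0)) :=
    ((tendsto_growthTail a b c (α + β)).comp (tendsto_add_atTop_nat 1)).const_mul _
  rw [mul_zero] at htail
  -- A time at which a reachable rescaled value is within `δ / 2` of `y` and the remaining variance
  -- is below `(δ / 2)²`.
  obtain ⟨N, ⟨i, j, hij, hnear⟩, hN⟩ := ((h.exists_composition_near hs u y (half_pos hδ)).and
    (htail.eventually (gt_mem_nhds (show 0 < (δ / 2) ^ 2 by positivity)))).exists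
  set v := u + i • (a, b) + j • (c, d) with hv
  set n := N + 1 with hn
  set m := 1 / growth a b c (α + β) n * u₂ a b c v with hm
  have hvn : v.1 + v.2 = α + β + n * (a + b) := by
    have hS := h.balanced
    have h1 : v.1 + v.2 = u.1 + u.2 + (i * (a + b) + j * (c + d)) := by simp [hv]; ring
    rw [h1, hu, ← hS, ← add_mul, hij, hn]
    ring
  have hpos : 0 < μ.real (U n ⁻¹' {v}) := by
    rw [hU.measureReal_preimage h.balanced h.rows_ne, hn, ← hij]
    refine hreach _ (fun w => Set.indicator_nonneg (fun _ _ => zero_le_one) w) i j ?_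
    rw [← hv, Set.indicator_of_mem (Set.mem_singleton v)]
    exact zero_lt_one
  have hmA : MeasurableSet (U n ⁻¹' {v}) := hU.measurable n (measurableSet_singleton v)
  -- Truncating the square at `(δ / 2)²` lets dominated convergence pass to the limit.
  have hl : Tendsto (fun k => ∫ ω in U n ⁻¹' {v},
      min ((1 / growth a b c (α + β) (n + k) * u₂ a b c (U (n + k) ω) - m) ^ 2) ((δ / 2) ^ 2) ∂μ)
      atTop (𝓝 (∫ ω in U n ⁻¹' {v}, min ((M ω - m) ^ 2) ((δ / 2) ^ 2) ∂μ)) := by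
    refine tendsto_integral_of_dominated_convergence (fun _ => (δ / 2) ^ 2) (fun k => ?_)
      (integrable_const _) (fun k => .of_forall fun ω => ?_) (ae_restrict_of_ae ?_)
    · exact ((Measurable.of_discrete (f := fun w : ℕ × ℕ =>
        min ((1 / growth a b c (α + β) (n + k) * u₂ a b c w - m) ^ 2) ((δ / 2) ^ 2))).comp
        (hU.measurable (n + k))).aestronglyMeasurable
    · rw [Real.norm_of_nonneg (by positivity)]
      exact min_le_right _ _
    · filter_upwards [hlim] with ω hω
      have h1 : Tendsto (fun k => 1 / growth a b c (α + β) (n + k) * u₂ a b c (U (n + k) ω)) atTop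
          (𝓝 (M ω)) := by
        refine (hω.comp (tendsto_add_atTop_nat n)).congr fun k => ?_
        simp only [Function.comp, add_comm k n]
      exact ((h1.sub_const m).pow 2).min tendsto_const_nhds
  have hle : ∀ k, ∫ ω in U n ⁻¹' {v},
      min ((1 / growth a b c (α + β) (n + k) * u₂ a b c (U (n + k) ω) - m) ^ 2) ((δ / 2) ^ 2) ∂μ ≤
      μ.real (U n ⁻¹' {v}) * (((a : ℝ) + b) ^ 2 * growthTail a b c (α + β) n) := by
    intro k
    refine le_trans (setIntegral_mono ?_ ?_ fun ω => min_le_left _ _)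
      (hU.setIntegral_sq_le h hs n k hvn)
    · exact (hU.integrable_comp h.balanced (fun w =>
        min ((1 / growth a b c (α + β) (n + k) * u₂ a b c w - m) ^ 2) ((δ / 2) ^ 2))
        (n + k)).integrableOn
    · exact (hU.integrable_comp h.balanced (fun w =>
        (1 / growth a b c (α + β) (n + k) * u₂ a b c w - m) ^ 2) (n + k)).integrableOn
  have hle' := le_of_tendsto hl (.of_forall hle)
  -- If `M` stays at distance `δ` from `y`, it stays at distance `δ / 2` from `m`, so the truncation
  -- is always active; this contradicts the variance bound on an event of positive probability.
  have heq : ∫ ω in U n ⁻¹' {v}, min ((M ω - m) ^ 2) ((δ / 2) ^ 2) ∂μ =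
      μ.real (U n ⁻¹' {v}) * (δ / 2) ^ 2 := by
    rw [integral_congr_ae (g := fun _ => (δ / 2) ^ 2), setIntegral_const, smul_eq_mul]
    refine ae_restrict_of_ae ?_
    filter_upwards [hfar] with ω hω
    refine min_eq_right ?_
    rw [← sq_abs (M ω - m)]
    refine pow_le_pow_left₀ (by positivity) ?_ 2
    have h1 := abs_sub_le (M ω) m y
    linarith
  rw [heq] at hle'
  have := lt_of_mul_lt_mul_left (hle'.trans_lt (mul_lt_mul_of_pos_left hN hpos)) hpos.le
  exact this.false

theorem support_map_eq_univ [IsProbabilityMeasure μ] (hU : IsProcess μ a b c d α β U)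
    (hs : 0 < α + β) {M : Ω → ℝ} (hM : Measurable M)
    (hlim : ∀ᵐ ω ∂μ, Tendsto (fun n => 1 / growth a b c (α + β) n * u₂ a b c (U n ω)) atTop
      (𝓝 (M ω))) :
    (μ.map fun ω => growthConst a b c (α + β) * M ω).support = Set.univ := by
  have hκ := h.growthConst_pos hs
  set κ := growthConst a b c (α + β)
  refine Set.eq_univ_of_forall fun x => ?_
  by_contra hx
  obtain ⟨V, hV, hV0⟩ := Measure.notMem_support_iff_exists.1 hx
  obtain ⟨ε, hε, hball⟩ := Metric.mem_nhds_iff.1 hV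
  have h0 := measure_mono_null hball hV0
  rw [Measure.map_apply (hM.const_mul _) Metric.isOpen_ball.measurableSet] at h0
  refine hU.not_ae_le_abs_sub h hs hlim (x / κ) (div_pos hε hκ) ?_
  filter_upwards [measure_eq_zero_iff_ae_notMem.1 h0] with ω hω
  have h1 : ε ≤ |κ * M ω - x| := by simpa [Real.dist_eq] using hω
  rw [div_le_iff₀ hκ, ← abs_of_pos hκ, ← abs_mul, abs_of_pos hκ, sub_mul, div_mul_cancel₀ _ hκ.ne',
    mul_comm]
  exact h1

end IsProcess

end PolyaUrn

theorem mainTheorem6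
    (a b c d : ℕ) (hbalanced : a + b = c + d) (hb : b ≠ 0) (hc : c ≠ 0)
    (hlarge : 1 / 2 < PolyaUrn.ratio a b c)
    (α β : ℕ) (hαβ : (α, β) ≠ (0, 0))
    {Ω : Type*} [MeasurableSpace Ω] (μ : Measure Ω) [IsProbabilityMeasure μ]
    (U : ℕ → Ω → ℕ × ℕ) (hU : PolyaUrn.IsProcess μ a b c d α β U) :
    ∃ W : Ω → ℝ, PolyaUrn.IsLimit μ a b c U W ∧
      (∃ f : ℝ → ℝ, Continuous f ∧ (∀ x, 0 ≤ f x) ∧ (∃ C : ℝ, ∀ x, f x ≤ C) ∧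
        μ.map W = volume.withDensity (fun x => ENNReal.ofReal (f x))) ∧
      (μ.map W).support = Set.univ := by
  have h : PolyaUrn.IsLarge a b c d := ⟨hbalanced, hb, hc, hlarge⟩
  have hs : 0 < α + β := by
    rw [Nat.pos_iff_ne_zero]
    intro h0
    exact hαβ (Prod.ext (by simp; omega) (by simp; omega))
  obtain ⟨M, hM, hlim⟩ := hU.exists_tendsto h hs
  have hW := h.isLimit_of_tendsto hs hM hlim
  exact ⟨_, hW, exists_continuous_density_of_integrable_charFun (hU.integrable_charFun_map h hs hW),
    hU.support_map_eq_univ h hs hM hlim⟩
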